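/- **Setting.** Let $\mathcal X$ be a measurable space and $\mathcal Y=\{-1,1\}$. Let $\mathcal H\subseteq\mathcal Y^{\mathcal X}$ be a class of measurable hypotheses. A finite set $F\subseteq\mathcal X$ is *shattered* by $\mathcal H$ if every map $F\to\mathcal Y$ is the restriction of some $h\in\mathcal H$; the *VC dimension* of $\mathcal H$ is the supremum of $|F|$ over shattered $F$. For a hypothesis $h$ and a finite sequence $S\in(\mathcal X\times\mathcal Y)^*$ put $\Sigma_{\neq}(h,S)=\sum_{(x,y)\in S}\mathbf 1\{h(x)\ne y\}$. An *ERM learner* for $\mathcal H$ is a map $\mathcal A:(\mathcal X\times\mathcal Y)^*\to\mathcal H$ such that $\mathcal A(S)$ minimises the empirical error $\Sigma_{\neq}(h,S)/|S|$ over $h\in\mathcal H$, for every $S$. It is *measurable* if $(S,x)\mapsto\mathcal A(S)(x)$ is measurable on $(\mathcal X\times\mathcal Y)^n\times\mathcal X$ for every $n$. For a probability distribution $\mathcal D$ on $\mathcal X\times\mathcal Y$, a *best hypothesis* is an $h^\star\in\mathcal H$ that minimises $\Pr_{(x,y)\sim\mathcal D}[h(x)\neq y]$ over $h\in\mathcal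 H$. **Splitting scheme.** For sequences $S,T\in(\mathcal X\times\mathcal Y)^*$ with $|S|=3^k$ define a finite family $\mathcal S(S;T)$ of sequences recursively. Write $\sqcup$ for concatenation. If $k<6$, then $\mathcal S(S;T)$ consists of the single sequence $S\sqcup T$. If $k\ge 6$, cut $S$ into $27$ consecutive blocks $S_1,\dots,S_{27}$ of length $3^{k-3}$, let $S_{i,\sqcup}$ be the first $3^{k-6}$ entries of $S_i$ and $S_{i,\sqcap}$ the remaining $3^{k-3}-3^{k-6}$ entries, and let $\mathcal S(S;T)$ be the concatenation of the families $\mathcal S(S_{i,\sqcup};\,S_{i,\sqcap}\sqcup T)$, $i=1,\dots,27$. Put $s_\sqcap=\frac{27}{1-1/27}$, which is $|S|/|S_{i,\sqcap}|$ when $k\ge6$. Let $\mathcal A(S;T)=(\mathcal A(S'))_{S'\in\mathcal S(S;T)}$, a multiset of hypotheses, and let $$L_{\mathcal D}^{\alpha}(\mathcal A(S;T))=\Pr_{(x,y)\sim\mathcal D}\bigl[\text{at least an }\alpha\text{ fraction of the }h\in\mathcal A(S;T)\text{ satisfy }h(x)\ne y\bigr].$$ **Theorem.** There is a universal constant $c\ge1$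 such that the following holds. Let $\mathcal H$ be a class of measurable hypotheses of finite VC dimension $d$ on a measurable space $\mathcal X$, let $\mathcal A$ be a measurable ERM learner for $\mathcal H$, let $\mathcal D$ be a probability distribution on $\mathcal X\times\{-1,1\}$, and let $h^\star\in\mathcal H$ be a best hypothesis. Then for every $\delta\in(0,1)$, every $m=3^k$ with $k\in\mathbb N$ (including $k=0$), and every fixed $T\in(\mathcal X\times\{-1,1\})^*$, with probability at least $1-\delta$ over $S\sim\mathcal D^m$, $$L_{\mathcal D}^{10/243}(\mathcal A(S;T))\;\le\;\max_{S'\in\mathcal S(S;T)}\frac{c\,\Sigma_{\neq}(h^\star,S')}{m/s_\sqcap}+\frac{c\,(d+\ln(1/\delta))}{m}.$$ -/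

import Mathlib

open MeasureTheory

noncomputable section

namespace AgnosticVC

/-- The label set `{-1, +1}`. -/
abbrev Label : Type := ℤˣ

/-- Every set of labels is measurable. -/
instance : DiscreteMeasurableSpace Label :=
  ⟨fun s => ⟨Units.val '' s, MeasurableSet.of_discrete,
    Set.preimage_image_eq s Units.val_injective⟩⟩

/-- A labelled example over the domain `X`. -/
abbrev Example (X : Type*) : Type _ := X × Label

/-- A hypothesis (classifier) on `X`. -/
abbrev Hypothesis (X : Type*) : Type _ := X → Label

/-- A learner maps finite training sequences to hypotheses. -/
abbrev Learner (X : Type*) : Type _ := List (Example X) → Hypothesis X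

variable {X : Type*}

/-- `H` shatters the finite set `s`: every labelling of `s` is realised by some `h ∈ H`. -/
def Shatters (H : Set (Hypothesis X)) (s : Finset X) : Prop :=
  ∀ f : X → Label, ∃ h ∈ H, ∀ x ∈ s, h x = f x

/-- The VC dimension of `H`: the supremum of the sizes of the finite sets shattered by `H`. -/
def vcDim (H : Set (Hypothesis X)) : ℕ∞ :=
  ⨆ s : {s : Finset X // Shatters H s}, (s.1.card : ℕ∞)

/-- The number of entries of the training sequence `S`, with multiplicity, on which `h` errs. -/
def errCount (h : Hypothesis X) (S : List (Example X)) : ℕ :=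
  S.countP fun z => h z.1 ≠ z.2

/-- The empirical error of `h` on the training sequence `S`. -/
def empError (h : Hypothesis X) (S : List (Example X)) : ℝ :=
  (errCount h S : ℝ) / S.length

/-- The true error of `h` with respect to the distribution `D`. -/
def trueError [MeasurableSpace X] (D : Measure (Example X)) (h : Hypothesis X) : ℝ :=
  D.real {z | h z.1 ≠ z.2}

/-- `h` is a best hypothesis of `H` for the distribution `D`. -/
def IsBest [MeasurableSpace X] (D : Measure (Example X)) (H : Set (Hypothesis X))
    (h : Hypothesis X) : Prop :=
  h ∈ H ∧ ∀ g ∈ H, trueError D h ≤ trueError D g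

/-- `A` is an empirical risk minimisation learner for `H`. -/
def IsERM (H : Set (Hypothesis X)) (A : Learner X) : Prop :=
  ∀ S : List (Example X), A S ∈ H ∧ ∀ g ∈ H, empError (A S) S ≤ empError g S

/-- `A` is a measurable learner: for each sample size `n`, the prediction at `x` of the hypothesis
trained on `S` is a jointly measurable function of `(S, x)`. -/
def IsMeasurableLearner [MeasurableSpace X] (A : Learner X) : Prop :=
  ∀ n : ℕ, Measurable fun p : (Fin n → Example X) × X => A (List.ofFn p.1) p.2

/-- The recursive splitting scheme, for an active sequence `S` of length `3 ^ k`. If `6 ≤ k`, then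
`S` is cut into 27 consecutive blocks of length `3 ^ (k - 3)`; the recursion is run, for every
block, on its first `3 ^ (k - 6)` entries, and its other entries are put in front of `T`. -/
def split {Z : Type*} (k : ℕ) (S T : List Z) : List (List Z) :=
  if 6 ≤ k then
    (List.range 27).flatMap fun i =>
      let block := (S.drop (i * 3 ^ (k - 3))).take (3 ^ (k - 3))
      split (k - 6) (block.take (3 ^ (k - 6))) (block.drop (3 ^ (k - 6)) ++ T)
  else [S ++ T]
termination_by k

theorem split_ne_nil {Z : Type*} (k : ℕ) (S T : List Z) : split k S T ≠ [] := by
  induction k using Nat.strong_induction_on generalizing S T with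
  | _ k ih =>
    unfold split
    split_ifs with h
    · intro h0
      rw [List.flatMap_eq_nil_iff] at h0
      exact ih (k - 6) (by omega) _ _ (h0 0 (by simp))
    · simp

/-- The multiset (as a list) of the hypotheses that `A` outputs on the members of the family that
the splitting scheme returns. -/
def ensemble (A : Learner X) (k : ℕ) (S T : List (Example X)) : List (Hypothesis X) :=
  (split k S T).map A

/-- The fraction of the hypotheses in the list `L` that err on the example `z`. -/
def avgErr (L : List (Hypothesis X)) (z : Example X) : ℝ :=
  (L.countP fun h => h z.1 ≠ z.2 : ℝ) / L.length

/-- The probability over an example from `D` that at least an `α` fraction of the hypotheses in `L`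
err on it. -/
def ensembleError [MeasurableSpace X] (D : Measure (Example X)) (α : ℝ)
    (L : List (Hypothesis X)) : ℝ :=
  D.real {z | α ≤ avgErr L z}

/-- The ratio `|S| / |S_⊓| = 3 ^ k / (3 ^ (k - 3) - 3 ^ (k - 6))` of the splitting scheme. -/
def sCap : ℝ := 27 / (1 - 1 / 27)

theorem ratio_eq_sCap (k : ℕ) (h : 6 ≤ k) :
    (3 ^ k : ℝ) / (3 ^ (k - 3) - 3 ^ (k - 6)) = sCap := by
  obtain ⟨j, rfl⟩ := Nat.exists_eq_add_of_le' h
  have h3 : j + 6 - 3 = j + 3 := by omega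
  rw [h3, Nat.add_sub_cancel, sCap, pow_add, pow_add]
  have hj : (3 : ℝ) ^ j ≠ 0 := by positivity
  rw [show (3 : ℝ) ^ j * 3 ^ 3 - 3 ^ j = 3 ^ j * 26 by ring]
  field_simp
  norm_num

end AgnosticVC

end

/-! The proof is by induction on `k` in steps of 6, for all `T` and all confidence levels at once.
Let M = 3^k be the active length of a recursive call inside a call of length 3^(k+6), s the largest
error count of `hStar` on a training sequence, L = ln(1/δ) and V = s + d + L.

If at least 10/243 of the union of the 27 sub-ensembles err at z, their error fractions sum to at
least 10/9. So some sub-ensemble i reaches 10/243, and the others still carry 1/9. Hence the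
ensemble error is at most 9·27·26 times any common bound on P(R_i ∩ {g errs}), where R_i is the
region on which ensemble i is bad and g belongs to an ensemble j ≠ i (`ensembleError_flatMap_le`).

By induction M·P(R_i) = O(V). The tail of block j has 26M entries, is independent of R_i, and lies
in every training sequence of ensemble j, so g makes at most s errors on it
(`IsERM.errCount_blockTail_le`). Passing from empirical to true error inside R_i must not cost a
factor log(M/d). In `measure_exists_lt_le` a Sauer bound that counts only points of R_i, combined
with symmetrization, costs d log ρ + 2nP(R_i)/ρ. For a large constant ρ the first term is O(d) and
the second a small fraction of the inductive bound, so the constant 3^16 reproduces itself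
(`exists_fails_of_failsBound`).

The 27 blocks and 27·26 ordered pairs give 3^6 events, each allotted failure probability δ/3^6. The
increase of L by log 3^6 is absorbed within each level when d ≥ 1. For d = 0 the class is a single
hypothesis and is treated directly. -/

noncomputable section

namespace AgnosticVC

open scoped ENNReal NNReal
open ProbabilityTheory

/-! ### Sauer–Shelah bound localised to a region -/

section Traces

variable {Z : Type*}

/-- The family `C` of sets shatters no finite set with more than `d` elements. -/
def VCBound (C : Set (Set Z)) (d : ℕ) : Prop :=
  ∀ w : Finset Z, (∀ t : Finset Z, t ⊆ w → ∃ c ∈ C, ∀ x ∈ w, x ∈ c ↔ x ∈ t) → w.card ≤ d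

open scoped Classical in
/-- The traces of the family `C` of sets on an indexed family of points. -/
def traces {κ : Type*} [Fintype κ] (C : Set (Set Z)) (z : κ → Z) : Finset (Finset κ) :=
  Finset.univ.filter fun B => ∃ c ∈ C, ∀ i, i ∈ B ↔ z i ∈ c

/-- The trace of a singleton separates its index from the other shattered ones, so the points over a
shattered index set are distinct. -/
theorem VCBound.card_le_of_shatters_traces {κ : Type*} [Fintype κ] [DecidableEq κ]
    {C : Set (Set Z)} {d : ℕ} (hC : VCBound C d) (z : κ → Z) (s : Finset κ)
    (hs : (traces C z).Shatters s) : s.card ≤ d := by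
  classical
  have key : ∀ t ⊆ s, ∃ c ∈ C, ∀ i ∈ s, z i ∈ c ↔ i ∈ t := by
    intro t ht
    obtain ⟨u, hu, hut⟩ := hs ht
    simp only [traces, Finset.mem_filter, Finset.mem_univ, true_and] at hu
    obtain ⟨c, hc, hcu⟩ := hu
    refine ⟨c, hc, fun i hi => ?_⟩
    rw [← hut, Finset.mem_inter, ← hcu i]
    simp [hi]
  have hinj : Set.InjOn z s := by
    intro i hi j hj hij
    obtain ⟨c, -, h⟩ := key {i} (by simpa using hi)
    have h1 := (h i hi).2 (by simp)
    rw [hij, h j hj] at h1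
    exact (Finset.mem_singleton.1 h1).symm
  rw [← Finset.card_image_of_injOn hinj]
  refine hC _ fun t ht => ?_
  obtain ⟨c, hc, h⟩ := key (s.filter fun i => z i ∈ t) (Finset.filter_subset _ _)
  refine ⟨c, hc, fun x hx => ?_⟩
  obtain ⟨i, hi, rfl⟩ := Finset.mem_image.1 hx
  rw [h i hi, Finset.mem_filter]
  simp [hi]

open scoped Classical in
-- By Pajor's inequality there are at most as many traces as shattered index sets. These have at
-- most `d` elements, all over `R`. Giving each the weight ρ^(d - |s|) ≥ 1 and then dropping the
-- size restriction leaves a binomial sum.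
theorem VCBound.card_traces_le {κ : Type*} [Fintype κ] {C : Set (Set Z)} {d : ℕ}
    (hC : VCBound C d) {R : Set Z} (hR : ∀ c ∈ C, c ⊆ R) {ρ : ℝ≥0} (hρ : 1 ≤ ρ) (z : κ → Z) :
    ((traces C z).card : ℝ≥0) ≤ ρ ^ d * ∏ i, if z i ∈ R then 1 + ρ⁻¹ else 1 := by
  set I : Finset κ := Finset.univ.filter fun i => z i ∈ R
  have hρ0 : 0 < ρ := lt_of_lt_of_le one_pos hρ
  have hsub : (traces C z).shatterer ⊆ I.powerset.filter fun s => s.card ≤ d := by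
    intro s hs
    rw [Finset.mem_shatterer] at hs
    refine Finset.mem_filter.2 ⟨Finset.mem_powerset.2 fun i hi => ?_,
      hC.card_le_of_shatters_traces z s hs⟩
    obtain ⟨u, hu, hsu⟩ := hs.exists_superset
    simp only [traces, Finset.mem_filter, Finset.mem_univ, true_and] at hu
    obtain ⟨c, hc, hcu⟩ := hu
    simpa [I] using hR c hc ((hcu i).1 (hsu hi))
  calc ((traces C z).card : ℝ≥0)
      ≤ ((I.powerset.filter fun s => s.card ≤ d).card : ℝ≥0) := by
        exact_mod_cast (Finset.card_le_card_shatterer _).trans (Finset.card_le_card hsub)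
    _ = ∑ s ∈ I.powerset.filter (fun s => s.card ≤ d), (1 : ℝ≥0) := by simp
    _ ≤ ∑ s ∈ I.powerset.filter (fun s => s.card ≤ d), ρ ^ d * ρ⁻¹ ^ s.card := by
        refine Finset.sum_le_sum fun s hs => ?_
        rw [inv_pow, ← div_eq_mul_inv, one_le_div (by positivity)]
        exact pow_le_pow_right₀ hρ (Finset.mem_filter.1 hs).2
    _ ≤ ∑ s ∈ I.powerset, ρ ^ d * ρ⁻¹ ^ s.card :=
        Finset.sum_le_sum_of_subset (Finset.filter_subset _ _)
    _ = ρ ^ d * (1 + ρ⁻¹) ^ I.card := by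
        rw [← Finset.mul_sum, add_comm, ← Finset.sum_pow_mul_eq_add_pow]
        simp
    _ = _ := by
        rw [Finset.prod_ite, Finset.prod_const, Finset.prod_const_one, mul_one]

end Traces

/-! ### Symmetrization with a ghost sample -/

section Symmetrization

variable {Z : Type*}

/-- Exchange the two components of the pairs whose index is marked by `σ`. -/
def swapBy {κ : Type*} (σ : κ → Bool) (z : κ → Z × Z) : κ → Z × Z :=
  fun i => if σ i then (z i).swap else z i

/-- The weight of a pair consisting of a sample point and a ghost sample point, in terms of
their membership in a set. -/
def pairWeight (a b : Prop) [Decidable a] [Decidable b] : ℝ≥0∞ :=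
  (if a then 4 / 9 else 1) * (if b then 3 / 2 else 1)

/-- The sum is 4/3, 35/18 or 2 when both, exactly one or none of the propositions hold: a randomly
exchanged pair has mean weight at most 1. -/
theorem pairWeight_add_le (a b : Prop) [Decidable a] [Decidable b] :
    pairWeight a b + pairWeight b a ≤ 2 := by
  have h49 : (4 / 9 : ℝ≥0∞) = ((4 / 9 : ℝ≥0) : ℝ≥0∞) := by
    rw [ENNReal.coe_div (by norm_num)]; norm_num
  have h32 : (3 / 2 : ℝ≥0∞) = ((3 / 2 : ℝ≥0) : ℝ≥0∞) := by
    rw [ENNReal.coe_div (by norm_num)]; norm_num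
  unfold pairWeight
  rw [h49, h32]
  split_ifs <;> norm_cast <;> rw [← NNReal.coe_le_coe] <;> push_cast <;> norm_num

theorem sum_prod_pairWeight_le {κ : Type*} [Fintype κ] [DecidableEq κ] (B : Finset (κ × Bool)) :
    ∑ σ : κ → Bool, ∏ i, pairWeight ((i, σ i) ∈ B) ((i, !σ i) ∈ B) ≤ 2 ^ Fintype.card κ := by
  rw [← Fintype.prod_sum fun (i : κ) (b : Bool) => pairWeight ((i, b) ∈ B) ((i, !b) ∈ B)]
  refine (Finset.prod_le_prod' (g := fun _ => 2) fun i _ => ?_).trans (by simp)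
  simpa using pairWeight_add_le ((i, true) ∈ B) ((i, false) ∈ B)

open scoped Classical in
/-- The weight of a sample and a ghost sample with respect to data dependent sets. -/
def symWeight {κ ι : Type*} [Fintype κ] (E : ι → (κ → Z) → Set Z) (z : κ → Z × Z) : ℝ≥0∞ :=
  ⨆ l, ∏ i, pairWeight ((z i).1 ∈ E l fun j => (z j).1) ((z i).2 ∈ E l fun j => (z j).1)

open scoped Classical in
-- Exchanges only permute the 2n points, so each `E l S`, although it depends on the exchanged
-- sample, cuts out a trace on a fixed family. The supremum is at most the sum over those traces,
-- and for a fixed trace the sum over exchanges factorises.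
theorem sum_symWeight_swapBy_le {κ ι : Type*} [Fintype κ] [Finite ι] {C : Set (Set Z)} {d : ℕ}
    (hC : VCBound C d) {R : Set Z} (hR : ∀ c ∈ C, c ⊆ R) {ρ : ℝ≥0} (hρ : 1 ≤ ρ)
    {E : ι → (κ → Z) → Set Z} (hE : ∀ l S, E l S ∈ C) (z : κ → Z × Z) :
    ∑ σ : κ → Bool, symWeight E (swapBy σ z) ≤ 2 ^ Fintype.card κ * (ρ ^ d *
      ∏ i, ((if (z i).1 ∈ R then 1 + (ρ : ℝ≥0∞)⁻¹ else 1) *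
        (if (z i).2 ∈ R then 1 + (ρ : ℝ≥0∞)⁻¹ else 1))) := by
  set pt : κ × Bool → Z := fun p => if p.2 then (z p.1).2 else (z p.1).1
  have hcard := hC.card_traces_le hR hρ pt
  have h1 : ∀ σ : κ → Bool, symWeight E (swapBy σ z) ≤
      ∑ B ∈ traces C pt, ∏ i, pairWeight ((i, σ i) ∈ B) ((i, !σ i) ∈ B) := by
    intro σ
    refine iSup_le fun l => ?_
    set F := E l fun j => (swapBy σ z j).1
    have hB : Finset.univ.filter (fun p => pt p ∈ F) ∈ traces C pt := by
      simp only [traces, Finset.mem_filter, Finset.mem_univ, true_and]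
      exact ⟨F, hE _ _, fun i => Iff.rfl⟩
    refine le_trans (le_of_eq ?_) (Finset.single_le_sum
      (f := fun B => ∏ i, pairWeight ((i, σ i) ∈ B) ((i, !σ i) ∈ B))
      (fun _ _ => zero_le) hB)
    refine Finset.prod_congr rfl fun i _ => ?_
    have e1 : (swapBy σ z i).1 = pt (i, σ i) := by
      cases h : σ i <;> simp [swapBy, pt, h]
    have e2 : (swapBy σ z i).2 = pt (i, !σ i) := by
      cases h : σ i <;> simp [swapBy, pt, h]
    simp only [Finset.mem_filter, Finset.mem_univ, true_and, e1, e2]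
  calc ∑ σ : κ → Bool, symWeight E (swapBy σ z)
      ≤ ∑ σ : κ → Bool, ∑ B ∈ traces C pt, ∏ i, pairWeight ((i, σ i) ∈ B) ((i, !σ i) ∈ B) :=
        Finset.sum_le_sum fun σ _ => h1 σ
    _ = ∑ B ∈ traces C pt, ∑ σ : κ → Bool, ∏ i, pairWeight ((i, σ i) ∈ B) ((i, !σ i) ∈ B) :=
        Finset.sum_comm
    _ ≤ ∑ B ∈ traces C pt, 2 ^ Fintype.card κ :=
        Finset.sum_le_sum fun B _ => sum_prod_pairWeight_le B
    _ = 2 ^ Fintype.card κ * ((traces C pt).card : ℝ≥0∞) := by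
        rw [Finset.sum_const, nsmul_eq_mul, mul_comm]
    _ ≤ _ := by
        gcongr
        have h2 : ((traces C pt).card : ℝ≥0∞) ≤
            ((ρ ^ d * ∏ i, if pt i ∈ R then 1 + ρ⁻¹ else 1 : ℝ≥0) : ℝ≥0∞) := by
          exact_mod_cast ENNReal.coe_le_coe.2 hcard
        refine h2.trans (le_of_eq ?_)
        have hρ0 : ρ ≠ 0 := (lt_of_lt_of_le one_pos hρ).ne'
        rw [ENNReal.coe_mul, ENNReal.coe_pow, ENNReal.ofNNReal_finsetProd, Fintype.prod_prod_type]
        congr 1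
        refine Finset.prod_congr rfl fun i _ => ?_
        rw [Fintype.prod_bool, mul_comm]
        simp only [pt, apply_ite (fun x : ℝ≥0 => (x : ℝ≥0∞)), ENNReal.coe_add, ENNReal.coe_one,
          ENNReal.coe_inv hρ0]
        simp

variable [MeasurableSpace Z]

theorem lintegral_pi_prod {κ : Type*} [Fintype κ] (μ : Measure Z) [IsProbabilityMeasure μ]
    {f : Z → ℝ≥0∞} (hf : Measurable f) :
    ∫⁻ z : κ → Z, ∏ i, f (z i) ∂Measure.pi (fun _ => μ) = (∫⁻ x, f x ∂μ) ^ Fintype.card κ := by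
  rw [lintegral_prod_eq_prod_lintegral_of_indepFun Finset.univ (fun i (z : κ → Z) => f (z i))
    (iIndepFun_pi (μ := fun _ : κ => μ) (X := fun _ => f) fun _ => hf.aemeasurable)
    (fun i => by fun_prop)]
  simp only [(measurePreserving_eval (fun _ : κ => μ) _).lintegral_comp hf, Finset.prod_const,
    Finset.card_univ]

theorem measurePreserving_swapBy {κ : Type*} [Fintype κ] (μ : Measure Z) [IsProbabilityMeasure μ]
    (σ : κ → Bool) : MeasurePreserving (swapBy σ) (Measure.pi fun _ : κ => μ.prod μ)
      (Measure.pi fun _ : κ => μ.prod μ) := by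
  refine measurePreserving_pi (fun _ => μ.prod μ) (fun _ => μ.prod μ)
    (f := fun i p => if σ i then p.swap else p) fun i => ?_
  by_cases h : σ i
  · simpa [h] using Measure.measurePreserving_swap (μ := μ) (ν := μ)
  · simpa [h, Function.id_def] using MeasurePreserving.id (μ.prod μ)

open scoped Classical in
theorem lintegral_ite_one_add (μ : Measure Z) [IsProbabilityMeasure μ] {R : Set Z}
    (hR : MeasurableSet R) (a : ℝ≥0∞) :
    ∫⁻ x, (if x ∈ R then 1 + a else 1) ∂μ = 1 + a * μ R := by
  have : ∀ x, (if x ∈ R then 1 + a else 1) = 1 + R.indicator (fun _ => a) x := by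
    intro x
    by_cases h : x ∈ R <;> simp [h]
  simp_rw [this]
  rw [lintegral_add_left measurable_const, lintegral_indicator_const hR]
  simp

open scoped Classical in
theorem measurable_symWeight {κ ι : Type*} [Fintype κ] [Finite ι] {E : ι → (κ → Z) → Set Z}
    (hEm : ∀ l, MeasurableSet {p : (κ → Z) × Z | p.2 ∈ E l p.1}) : Measurable (symWeight E) := by
  refine Measurable.iSup fun l => Finset.measurable_prod _ fun i _ => Measurable.mul ?_ ?_
  · refine Measurable.ite ?_ measurable_const measurable_const
    exact (hEm l).preimage (f := fun z : κ → Z × Z => (fun j => (z j).1, (z i).1)) (by fun_prop)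
  · refine Measurable.ite ?_ measurable_const measurable_const
    exact (hEm l).preimage (f := fun z : κ → Z × Z => (fun j => (z j).1, (z i).2)) (by fun_prop)

/-- Each exchange preserves the law of the pairs, so the integral equals its average over all
exchanges. -/
theorem lintegral_symWeight_le {κ ι : Type*} [Fintype κ] [Finite ι] (μ : Measure Z)
    [IsProbabilityMeasure μ] {C : Set (Set Z)} {d : ℕ}
    (hC : VCBound C d) {R : Set Z} (hRm : MeasurableSet R) (hR : ∀ c ∈ C, c ⊆ R) {ρ : ℝ≥0}
    (hρ : 1 ≤ ρ) {E : ι → (κ → Z) → Set Z} (hE : ∀ l S, E l S ∈ C)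
    (hEm : ∀ l, MeasurableSet {p : (κ → Z) × Z | p.2 ∈ E l p.1}) :
    ∫⁻ z, symWeight E z ∂(Measure.pi fun _ : κ => μ.prod μ) ≤
      ρ ^ d * (1 + (ρ : ℝ≥0∞)⁻¹ * μ R) ^ (2 * Fintype.card κ) := by
  classical
  have hm := measurable_symWeight hEm
  have hcard : (Fintype.card (κ → Bool) : ℝ≥0∞) = 2 ^ Fintype.card κ := by simp
  have h2 : (2 : ℝ≥0∞) ^ Fintype.card κ ≠ 0 := by positivity
  have h2' : (2 : ℝ≥0∞) ^ Fintype.card κ ≠ ∞ := by finiteness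
  refine (ENNReal.mul_le_mul_iff_right h2 h2').1 ?_
  calc 2 ^ Fintype.card κ * ∫⁻ z, symWeight E z ∂(Measure.pi fun _ : κ => μ.prod μ)
      = ∑ σ : κ → Bool, ∫⁻ z, symWeight E (swapBy σ z) ∂(Measure.pi fun _ : κ => μ.prod μ) := by
        simp only [(measurePreserving_swapBy μ _).lintegral_comp hm, Finset.sum_const,
          Finset.card_univ, nsmul_eq_mul, hcard]
    _ = ∫⁻ z, ∑ σ : κ → Bool, symWeight E (swapBy σ z) ∂(Measure.pi fun _ : κ => μ.prod μ) :=
        (lintegral_finsetSum _ fun σ _ => hm.comp (measurePreserving_swapBy μ σ).measurable).symm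
    _ ≤ ∫⁻ z, 2 ^ Fintype.card κ * (ρ ^ d * ∏ i, ((if (z i).1 ∈ R then 1 + (ρ : ℝ≥0∞)⁻¹ else 1) *
          (if (z i).2 ∈ R then 1 + (ρ : ℝ≥0∞)⁻¹ else 1))) ∂(Measure.pi fun _ : κ => μ.prod μ) :=
        lintegral_mono fun z => sum_symWeight_swapBy_le hC hR hρ hE z
    _ = _ := by
        have hf : Measurable fun x : Z => if x ∈ R then 1 + (ρ : ℝ≥0∞)⁻¹ else 1 :=
          Measurable.ite hRm measurable_const measurable_const
        have hg : Measurable fun p : Z × Z => (if p.1 ∈ R then 1 + (ρ : ℝ≥0∞)⁻¹ else 1) *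
            (if p.2 ∈ R then 1 + (ρ : ℝ≥0∞)⁻¹ else 1) :=
          (hf.comp measurable_fst).mul (hf.comp measurable_snd)
        have hG : Measurable fun z : κ → Z × Z => ∏ i,
            ((if (z i).1 ∈ R then 1 + (ρ : ℝ≥0∞)⁻¹ else 1) *
            (if (z i).2 ∈ R then 1 + (ρ : ℝ≥0∞)⁻¹ else 1)) :=
          Finset.measurable_prod _ fun i _ => hg.comp (measurable_pi_apply i)
        rw [lintegral_const_mul _ (hG.const_mul _), lintegral_const_mul _ hG,
          lintegral_pi_prod (μ.prod μ) hg,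
          lintegral_prod_mul hf.aemeasurable hf.aemeasurable,
          lintegral_ite_one_add μ hRm, ← sq, ← pow_mul]

open scoped Classical in
/-- Exponential moment form of the relative uniform convergence of data dependent sets. -/
theorem lintegral_iSup_pow_mul_prod_le {κ ι : Type*} [Fintype κ] [Finite ι] (μ : Measure Z)
    [IsProbabilityMeasure μ] {C : Set (Set Z)} {d : ℕ}
    (hC : VCBound C d) {R : Set Z} (hRm : MeasurableSet R) (hR : ∀ c ∈ C, c ⊆ R) {ρ : ℝ≥0}
    (hρ : 1 ≤ ρ) {E : ι → (κ → Z) → Set Z} (hE : ∀ l S, E l S ∈ C)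
    (hEm : ∀ l, MeasurableSet {p : (κ → Z) × Z | p.2 ∈ E l p.1}) :
    ∫⁻ S, ⨆ l, (∏ i, if S i ∈ E l S then 4 / 9 else 1) *
        (1 + 2⁻¹ * μ (E l S)) ^ Fintype.card κ ∂(Measure.pi fun _ : κ => μ) ≤
      ρ ^ d * (1 + (ρ : ℝ≥0∞)⁻¹ * μ R) ^ (2 * Fintype.card κ) := by
  refine le_trans ?_ (lintegral_symWeight_le μ hC hRm hR hρ hE hEm)
  set e := MeasurableEquiv.arrowProdEquivProdArrow Z Z κ
  have hmp : MeasurePreserving e.symm _ _ :=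
    (measurePreserving_arrowProdEquivProdArrow Z Z κ (fun _ => μ) (fun _ => μ)).symm
  have hm := measurable_symWeight hEm
  rw [← hmp.lintegral_comp hm, lintegral_prod (fun p => symWeight E (e.symm p))
    (hm.comp hmp.measurable).aemeasurable]
  refine lintegral_mono fun S => iSup_le fun l => ?_
  have hES : MeasurableSet (E l S) := (hEm l).preimage measurable_prodMk_left
  have h32 : (3 / 2 : ℝ≥0∞) = 1 + 2⁻¹ := by
    rw [show (3 : ℝ≥0∞) = 2 + 1 by norm_num, ENNReal.add_div, ENNReal.div_self (by simp) (by simp)]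
    simp
  have hf : Measurable fun x : Z => if x ∈ E l S then (3 / 2 : ℝ≥0∞) else 1 :=
    Measurable.ite hES measurable_const measurable_const
  -- The set is determined by the sample alone, so integrating out the ghost points turns each
  -- factor 3/2 into 1 + μ(E l S)/2. The supremum then enters inside the integral.
  calc (∏ i, if S i ∈ E l S then 4 / 9 else 1) * (1 + 2⁻¹ * μ (E l S)) ^ Fintype.card κ
      = ∫⁻ g : κ → Z, (∏ i, if S i ∈ E l S then 4 / 9 else 1) *
          ∏ i, (if g i ∈ E l S then (3 / 2 : ℝ≥0∞) else 1) ∂(Measure.pi fun _ : κ => μ) := by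
        rw [lintegral_const_mul _ (Finset.measurable_prod (f := fun i (g : κ → Z) =>
          if g i ∈ E l S then (3 / 2 : ℝ≥0∞) else 1) _ fun i _ =>
          hf.comp (measurable_pi_apply i)), lintegral_pi_prod μ hf, h32, lintegral_ite_one_add μ hES]
    _ ≤ _ := by
        refine lintegral_mono fun g => ?_
        rw [← Finset.prod_mul_distrib]
        exact le_iSup (fun l => ∏ i, pairWeight _ _) l

end Symmetrization

/-! ### Relative deviation bound -/

section Tail

variable {Z : Type*} [MeasurableSpace Z]

/-- log(1 + q/2) ≥ 1 - 1/(1 + q/2) = q/(2 + q) ≥ q/3. -/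
theorem exp_div_three_le {q : ℝ} (h0 : 0 ≤ q) (h1 : q ≤ 1) : Real.exp (q / 3) ≤ 1 + q / 2 := by
  have hpos : 0 < 1 + q / 2 := by linarith
  rw [← Real.le_log_iff_exp_le hpos]
  refine le_trans ?_ (Real.one_sub_inv_le_log_of_pos hpos)
  rw [le_sub_iff_add_le, ← le_sub_iff_add_le', inv_le_comm₀ hpos (by linarith), inv_eq_one_div,
    div_le_iff₀ (by linarith)]
  nlinarith

open scoped Classical in
theorem measurable_iSup_weight {κ ι : Type*} [Fintype κ] [Finite ι] (μ : Measure Z)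
    [IsProbabilityMeasure μ] {E : ι → (κ → Z) → Set Z}
    (hEm : ∀ l, MeasurableSet {p : (κ → Z) × Z | p.2 ∈ E l p.1}) :
    Measurable fun S : κ → Z => ⨆ l, (∏ i, if S i ∈ E l S then (4 / 9 : ℝ≥0∞) else 1) *
        (1 + 2⁻¹ * μ (E l S)) ^ Fintype.card κ := by
  refine Measurable.iSup fun l => Measurable.mul ?_ ?_
  · refine Finset.measurable_prod _ fun i _ => Measurable.ite ?_ measurable_const measurable_const
    exact (hEm l).preimage (f := fun S : κ → Z => (S, S i)) (by fun_prop)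
  · have : Measurable fun S => μ (E l S) := measurable_measure_prodMk_left (hEm l)
    exact ((this.const_mul _).const_add _).pow_const _

open scoped Classical in
/-- Uniformly over finitely many data dependent sets, all of them members of a family of bounded
VC dimension of subsets of `R`, the probability of the set is controlled by its empirical
frequency, up to a small multiple of the probability of `R`. -/
theorem measure_exists_lt_le {κ ι : Type*} [Fintype κ] [Finite ι] (μ : Measure Z)
    [IsProbabilityMeasure μ] {C : Set (Set Z)} {d : ℕ}
    (hC : VCBound C d) {R : Set Z} (hRm : MeasurableSet R) (hR : ∀ c ∈ C, c ⊆ R) {ρ : ℝ}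
    (hρ : 1 ≤ ρ) {E : ι → (κ → Z) → Set Z} (hE : ∀ l S, E l S ∈ C)
    (hEm : ∀ l, MeasurableSet {p : (κ → Z) × Z | p.2 ∈ E l p.1}) (L : ℝ) :
    (Measure.pi fun _ : κ => μ) {S | ∃ l, ((Finset.univ.filter fun i => S i ∈ E l S).card : ℝ) +
        d * Real.log ρ + 2 * Fintype.card κ * μ.real R / ρ + L <
        Fintype.card κ * μ.real (E l S) / 3} ≤ ENNReal.ofReal (Real.exp (-L)) := by
  have hρ0 : 0 < ρ := lt_of_lt_of_le one_pos hρ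
  set n := Fintype.card κ
  lift ρ to ℝ≥0 using hρ0.le
  have hρ1 : (1 : ℝ≥0) ≤ ρ := by exact_mod_cast hρ
  have hmain := lintegral_iSup_pow_mul_prod_le μ hC hRm hR hρ1 hE hEm
  set K : ℝ≥0∞ := ρ ^ d * (1 + (ρ : ℝ≥0∞)⁻¹ * μ R) ^ (2 * n)
  set f : (κ → Z) → ℝ≥0∞ := fun S => ⨆ l, (∏ i, if S i ∈ E l S then (4 / 9 : ℝ≥0∞) else 1) *
        (1 + 2⁻¹ * μ (E l S)) ^ n
  have hf : Measurable f := measurable_iSup_weight μ hEm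
  have hρe : (ρ : ℝ≥0∞) ≠ 0 := by
    rw [Ne, ENNReal.coe_eq_zero]
    rintro rfl
    simp at hρ0
  have hKr : K = ENNReal.ofReal (ρ ^ d * (1 + μ.real R / ρ) ^ (2 * n)) := by
    rw [ENNReal.ofReal_mul (by positivity), ENNReal.ofReal_pow (by positivity),
      ENNReal.ofReal_pow (by positivity), ENNReal.ofReal_add (by positivity) (by positivity),
      ENNReal.ofReal_div_of_pos hρ0]
    simp [K, measureReal_def, ENNReal.div_eq_inv_mul]
  have hKpos : 0 < (ρ : ℝ) ^ d * (1 + μ.real R / ρ) ^ (2 * n) := by positivity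
  -- Markov's inequality will be applied at level K·e^L. On the event, log f is at least -N + nq/3
  -- because e^(-1) ≤ 4/9 and e^(q/3) ≤ 1 + q/2, while log K ≤ d log ρ + 2nP(R)/ρ.
  have hsub : {S | ∃ l, ((Finset.univ.filter fun i => S i ∈ E l S).card : ℝ) +
        d * Real.log ρ + 2 * n * μ.real R / ρ + L < n * μ.real (E l S) / 3} ⊆
        {S | K * ENNReal.ofReal (Real.exp L) ≤ f S} := by
    rintro S ⟨l, hl⟩
    refine le_trans ?_ (le_iSup (fun l => (∏ i, if S i ∈ E l S then (4 / 9 : ℝ≥0∞) else 1) *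
        (1 + 2⁻¹ * μ (E l S)) ^ n) l)
    set N := (Finset.univ.filter fun i => S i ∈ E l S).card
    set q := μ.real (E l S)
    have hq0 : 0 ≤ q := measureReal_nonneg
    have hq1 : q ≤ 1 := measureReal_le_one
    have e1 : (∏ i, if S i ∈ E l S then (4 / 9 : ℝ≥0∞) else 1) * (1 + 2⁻¹ * μ (E l S)) ^ n =
        ENNReal.ofReal ((4 / 9) ^ N * (1 + q / 2) ^ n) := by
      rw [Finset.prod_ite, Finset.prod_const, Finset.prod_const_one, mul_one,
        ENNReal.ofReal_mul (by positivity), ENNReal.ofReal_pow (by positivity),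
        ENNReal.ofReal_pow (by positivity), ENNReal.ofReal_add (by positivity) (by positivity),
        ENNReal.ofReal_div_of_pos (by norm_num), ENNReal.ofReal_div_of_pos (by norm_num)]
      simp [N, q, measureReal_def, ENNReal.div_eq_inv_mul]
    rw [e1, hKr, ← ENNReal.ofReal_mul hKpos.le]
    refine ENNReal.ofReal_le_ofReal ?_
    have h49 : Real.exp (-N) ≤ (4 / 9) ^ N := by
      have : Real.exp (-1) ≤ 4 / 9 := by
        have := Real.exp_neg_one_lt_d9
        linarith
      calc Real.exp (-N) = Real.exp (-1) ^ N := by rw [← Real.exp_nat_mul]; simp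
        _ ≤ _ := by gcongr
    have hqn : Real.exp (n * q / 3) ≤ (1 + q / 2) ^ n := by
      calc Real.exp (n * q / 3) = Real.exp (q / 3) ^ n := by
            rw [← Real.exp_nat_mul]; ring_nf
        _ ≤ _ := by gcongr; exact exp_div_three_le hq0 hq1
    have hp : (1 + μ.real R / ρ) ^ (2 * n) ≤ Real.exp (2 * n * μ.real R / ρ) := by
      calc (1 + μ.real R / ρ) ^ (2 * n) ≤ Real.exp (μ.real R / ρ) ^ (2 * n) := by
            gcongr
            rw [add_comm]
            exact Real.add_one_le_exp _
        _ = _ := by rw [← Real.exp_nat_mul]; push_cast; ring_nf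
    have hd : (ρ : ℝ) ^ d = Real.exp (d * Real.log ρ) := by
      rw [Real.exp_nat_mul, Real.exp_log hρ0]
    calc (ρ : ℝ) ^ d * (1 + μ.real R / ρ) ^ (2 * n) * Real.exp L
        ≤ Real.exp (d * Real.log ρ) * Real.exp (2 * n * μ.real R / ρ) * Real.exp L := by
          rw [hd]; gcongr
      _ = Real.exp (d * Real.log ρ + 2 * n * μ.real R / ρ + L) := by simp [Real.exp_add]
      _ ≤ Real.exp (-N + n * q / 3) := Real.exp_le_exp.2 (by linarith)
      _ = Real.exp (-N) * Real.exp (n * q / 3) := Real.exp_add _ _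
      _ ≤ _ := by gcongr
  have hK0 : K ≠ 0 := by rw [hKr]; exact (ENNReal.ofReal_pos.2 hKpos).ne'
  have hKt : K ≠ ∞ := by rw [hKr]; exact ENNReal.ofReal_ne_top
  have hL0 : ENNReal.ofReal (Real.exp L) ≠ 0 := (ENNReal.ofReal_pos.2 (Real.exp_pos L)).ne'
  refine (measure_mono hsub).trans ((meas_ge_le_lintegral_div hf.aemeasurable
    (mul_ne_zero hK0 hL0) (ENNReal.mul_ne_top hKt ENNReal.ofReal_ne_top)).trans ?_)
  calc (∫⁻ S, f S ∂Measure.pi fun _ => μ) / (K * ENNReal.ofReal (Real.exp L))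
      ≤ K / (K * ENNReal.ofReal (Real.exp L)) := by gcongr
    _ = ENNReal.ofReal (Real.exp (-L)) := by
      rw [Real.exp_neg, ENNReal.ofReal_inv_of_pos (Real.exp_pos L), ENNReal.div_eq_inv_mul,
        ENNReal.mul_inv (Or.inl hK0) (Or.inl hKt), mul_right_comm, ENNReal.inv_mul_cancel hK0 hKt,
        one_mul]

open scoped Classical in
/-- The version of `measure_exists_lt_le` with an independent parameter. -/
theorem measure_prod_exists_lt_le {Ω κ ι : Type*} [MeasurableSpace Ω] [Fintype κ] [Finite ι]
    (ν : Measure Ω) [IsProbabilityMeasure ν] (μ : Measure Z)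
    [IsProbabilityMeasure μ] {C : Ω → Set (Set Z)} {d : ℕ}
    (hC : ∀ ω, VCBound (C ω) d) {R : Ω → Set Z}
    (hRm : MeasurableSet {p : Ω × Z | p.2 ∈ R p.1}) (hR : ∀ ω, ∀ c ∈ C ω, c ⊆ R ω) {ρ : ℝ}
    (hρ : 1 ≤ ρ) {E : ι → Ω × (κ → Z) → Set Z} (hE : ∀ l p, E l p ∈ C p.1)
    (hEm : ∀ l, MeasurableSet {p : (Ω × (κ → Z)) × Z | p.2 ∈ E l p.1}) (L : ℝ) :
    (ν.prod (Measure.pi fun _ : κ => μ)) {p | ∃ l,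
        ((Finset.univ.filter fun i => p.2 i ∈ E l p).card : ℝ) +
        d * Real.log ρ + 2 * Fintype.card κ * μ.real (R p.1) / ρ + L <
        Fintype.card κ * μ.real (E l p) / 3} ≤ ENNReal.ofReal (Real.exp (-L)) := by
  have hEr : ∀ l, Measurable fun p => μ.real (E l p) := fun l =>
    (measurable_measure_prodMk_left (hEm l)).ennreal_toReal
  have hRr : Measurable fun ω => μ.real (R ω) :=
    (measurable_measure_prodMk_left hRm).ennreal_toReal
  have hN : ∀ l, Measurable fun p : Ω × (κ → Z) =>
      ((Finset.univ.filter fun i => p.2 i ∈ E l p).card : ℝ) := by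
    intro l
    simp only [Finset.card_filter, Nat.cast_sum, Nat.cast_ite, Nat.cast_one, Nat.cast_zero]
    refine Finset.measurable_sum _ fun i _ => Measurable.ite ?_ measurable_const measurable_const
    exact (hEm l).preimage (f := fun p : Ω × (κ → Z) => (p, p.2 i)) (by fun_prop)
  have hms : MeasurableSet {p : Ω × (κ → Z) | ∃ l,
        ((Finset.univ.filter fun i => p.2 i ∈ E l p).card : ℝ) +
        d * Real.log ρ + 2 * Fintype.card κ * μ.real (R p.1) / ρ + L <
        Fintype.card κ * μ.real (E l p) / 3} := by
    rw [Set.ofPred_exists]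
    refine MeasurableSet.iUnion fun l => measurableSet_lt ?_ ?_
    · exact (((hN l).add measurable_const).add (((hRr.comp measurable_fst).const_mul _).div_const
        _)).add measurable_const
    · exact ((hEr l).const_mul _).div_const _
  rw [Measure.prod_apply hms]
  refine (lintegral_mono (g := fun _ => ENNReal.ofReal (Real.exp (-L))) fun ω => ?_).trans
    (by simp)
  exact measure_exists_lt_le μ (hC ω) (hRm.preimage measurable_prodMk_left) (hR ω) hρ
    (E := fun l S => E l (ω, S)) (fun l S => hE l (ω, S)) (fun l => (hEm l).preimage
      (f := fun p : (κ → Z) × Z => ((ω, p.1), p.2)) (by fun_prop)) L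

end Tail

/-! ### Independent parts of a product sample -/

section Pi

variable {Z : Type*} [MeasurableSpace Z]

theorem measurePreserving_precomp {κ τ : Type*} [Fintype κ] [Fintype τ] (μ : Measure Z)
    [IsProbabilityMeasure μ] {e : κ → τ} (he : Function.Injective e) :
    MeasurePreserving (fun (z : τ → Z) a => z (e a)) (Measure.pi fun _ => μ)
      (Measure.pi fun _ => μ) := by
  refine ⟨by fun_prop, ?_⟩
  have h := (iIndepFun_pi (μ := fun _ : τ => μ) (X := fun _ z => z)
    fun _ => aemeasurable_id).precomp he
  rw [h.map_fun_eq_pi_map fun i => (measurable_pi_apply (e i)).aemeasurable]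
  simp only [(measurePreserving_eval (fun _ : τ => μ) _).map_eq]

theorem measurePreserving_precomp_prod {κ κ' τ : Type*} [Fintype κ] [Fintype κ'] [Fintype τ]
    (μ : Measure Z) [IsProbabilityMeasure μ] {e : κ → τ} {e' : κ' → τ}
    (he : Function.Injective e) (he' : Function.Injective e') (hee' : ∀ a b, e a ≠ e' b) :
    MeasurePreserving (fun z : τ → Z => ((fun a => z (e a)), (fun a => z (e' a))))
      (Measure.pi fun _ => μ) ((Measure.pi fun _ => μ).prod (Measure.pi fun _ => μ)) :=
  (measurePreserving_sumPiEquivProdPi fun _ : κ ⊕ κ' => μ).comp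
    (measurePreserving_precomp μ (e := Sum.elim e e') (he.sumElim he' hee'))

end Pi

/-! ### Combinatorics of the splitting scheme -/

section Split

variable {Z : Type*}

/-- The part of the `i`-th block of `S` on which the splitting scheme recurses. -/
def blockHead (j i : ℕ) (S : List Z) : List Z :=
  ((S.drop (i * 3 ^ (j + 3))).take (3 ^ (j + 3))).take (3 ^ j)

/-- The part of the `i`-th block of `S` that the splitting scheme puts in front of `T`. -/
def blockTail (j i : ℕ) (S : List Z) : List Z :=
  ((S.drop (i * 3 ^ (j + 3))).take (3 ^ (j + 3))).drop (3 ^ j)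

theorem split_add_six (j : ℕ) (S T : List Z) : split (j + 6) S T =
    (List.range 27).flatMap fun i => split j (blockHead j i S) (blockTail j i S ++ T) := by
  rw [split, if_pos (by omega)]
  rfl

theorem split_of_lt {k : ℕ} (hk : k < 6) (S T : List Z) : split k S T = [S ++ T] := by
  rw [split, if_neg (by omega)]

theorem split_induction {motive : ℕ → Prop} (k : ℕ) (base : ∀ k < 6, motive k)
    (step : ∀ j, motive j → motive (j + 6)) : motive k := by
  induction k using Nat.strong_induction_on with
  | _ k ih =>
    by_cases hk : k < 6
    · exact base k hk
    · obtain ⟨j, rfl⟩ := Nat.exists_eq_add_of_le' (not_lt.1 hk)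
      exact step j (ih j (by omega))

/-- By naturality the scheme can be run on functions of the randomness. A random ensemble then
becomes a fixed finite list of random hypotheses, on which all measurability arguments rest. -/
theorem split_map {Y : Type*} (f : Y → Z) (k : ℕ) (S T : List Y) :
    split k (S.map f) (T.map f) = (split k S T).map (List.map f) := by
  induction k using split_induction generalizing S T with
  | base k hk => simp [split_of_lt hk]
  | step j ih =>
    simp only [split_add_six, List.map_flatMap]
    congr 1
    funext i
    rw [← ih]
    simp [blockHead, blockTail]

theorem length_split (k : ℕ) (S T S' T' : List Z) :
    (split k S T).length = (split k S' T').length := by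
  induction k using split_induction generalizing S T S' T' with
  | base k hk => simp [split_of_lt hk]
  | step j ih =>
    simp only [split_add_six, List.length_flatMap]
    congr 2
    funext i
    exact ih _ _ _ _

theorem mem_of_mem_split {k : ℕ} {S T S' : List Z} (h : S' ∈ split k S T) {x : Z} (hx : x ∈ S') :
    x ∈ S ∨ x ∈ T := by
  induction k using split_induction generalizing S T S' with
  | base k hk =>
    rw [split_of_lt hk, List.mem_singleton] at h
    subst h
    simpa using hx
  | step j ih =>
    rw [split_add_six, List.mem_flatMap] at h
    obtain ⟨i, -, hi⟩ := h
    rcases ih hi hx with h | h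
    · exact Or.inl (List.mem_of_mem_drop (List.mem_of_mem_take (List.mem_of_mem_take h)))
    · rcases List.mem_append.1 h with h | h
      · exact Or.inl (List.mem_of_mem_drop (List.mem_of_mem_take (List.mem_of_mem_drop h)))
      · exact Or.inr h

theorem suffix_of_mem_split {k : ℕ} {S T S' : List Z} (h : S' ∈ split k S T) : T <:+ S' := by
  induction k using split_induction generalizing S T S' with
  | base k hk =>
    rw [split_of_lt hk, List.mem_singleton] at h
    subst h
    exact List.suffix_append _ _
  | step j ih =>
    rw [split_add_six, List.mem_flatMap] at h
    obtain ⟨i, -, hi⟩ := h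
    exact (List.suffix_append _ _).trans (ih hi)

/-- The position of the `a`-th entry of the head of the `i`-th block. -/
def headIdx (j : ℕ) (i : Fin 27) (a : Fin (3 ^ j)) : Fin (3 ^ (j + 6)) :=
  ⟨i * 3 ^ (j + 3) + a, by
    have := i.2; have := a.2
    have : (i : ℕ) * 3 ^ (j + 3) ≤ 26 * 3 ^ (j + 3) := Nat.mul_le_mul_right _ (by omega)
    have h3 : 3 ^ (j + 3) = 27 * 3 ^ j := by rw [pow_add]; ring
    have h6 : 3 ^ (j + 6) = 729 * 3 ^ j := by rw [pow_add]; ring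
    omega⟩

/-- The position of the `a`-th entry of the tail of the `i`-th block. -/
def tailIdx (j : ℕ) (i : Fin 27) (a : Fin (26 * 3 ^ j)) : Fin (3 ^ (j + 6)) :=
  ⟨i * 3 ^ (j + 3) + 3 ^ j + a, by
    have := i.2; have := a.2
    have : (i : ℕ) * 3 ^ (j + 3) ≤ 26 * 3 ^ (j + 3) := Nat.mul_le_mul_right _ (by omega)
    have h3 : 3 ^ (j + 3) = 27 * 3 ^ j := by rw [pow_add]; ring
    have h6 : 3 ^ (j + 6) = 729 * 3 ^ j := by rw [pow_add]; ring
    omega⟩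

/-- Block and offset can be read off from a position, which yields injectivity and the disjointness
of heads and tails. -/
theorem headIdx_div (j : ℕ) (i : Fin 27) (a : Fin (3 ^ j)) :
    (headIdx j i a : ℕ) / 3 ^ (j + 3) = i ∧ (headIdx j i a : ℕ) % 3 ^ (j + 3) = a := by
  have h : (a : ℕ) < 3 ^ (j + 3) := a.2.trans (Nat.pow_lt_pow_right (by norm_num) (by omega))
  have hp : 0 < 3 ^ (j + 3) := by positivity
  simp only [headIdx]
  rw [add_comm, Nat.add_mul_div_right _ _ hp, Nat.add_mul_mod_self_right, Nat.div_eq_of_lt h,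
    Nat.mod_eq_of_lt h]
  simp

theorem tailIdx_div (j : ℕ) (i : Fin 27) (a : Fin (26 * 3 ^ j)) :
    (tailIdx j i a : ℕ) / 3 ^ (j + 3) = i ∧
      (tailIdx j i a : ℕ) % 3 ^ (j + 3) = 3 ^ j + a := by
  have h : 3 ^ j + (a : ℕ) < 3 ^ (j + 3) := by
    have := a.2
    rw [pow_add]
    omega
  have hp : 0 < 3 ^ (j + 3) := by positivity
  simp only [tailIdx]
  rw [add_assoc, add_comm, Nat.add_mul_div_right _ _ hp, Nat.add_mul_mod_self_right,
    Nat.div_eq_of_lt h, Nat.mod_eq_of_lt h]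
  simp

theorem headIdx_inj {j : ℕ} {i i' : Fin 27} {a a' : Fin (3 ^ j)} :
    headIdx j i a = headIdx j i' a' ↔ i = i' ∧ a = a' := by
  refine ⟨fun h => ?_, by rintro ⟨rfl, rfl⟩; rfl⟩
  have h1 := headIdx_div j i a
  rw [h] at h1
  have h2 := headIdx_div j i' a'
  exact ⟨Fin.ext (h1.1.symm.trans h2.1), Fin.ext (h1.2.symm.trans h2.2)⟩

theorem tailIdx_inj {j : ℕ} {i i' : Fin 27} {a a' : Fin (26 * 3 ^ j)} :
    tailIdx j i a = tailIdx j i' a' ↔ i = i' ∧ a = a' := by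
  refine ⟨fun h => ?_, by rintro ⟨rfl, rfl⟩; rfl⟩
  have h1 := tailIdx_div j i a
  rw [h] at h1
  have h2 := tailIdx_div j i' a'
  exact ⟨Fin.ext (h1.1.symm.trans h2.1), Fin.ext (by omega)⟩

theorem headIdx_ne_tailIdx (j : ℕ) (i i' : Fin 27) (a : Fin (3 ^ j)) (a' : Fin (26 * 3 ^ j)) :
    headIdx j i a ≠ tailIdx j i' a' := by
  intro h
  have h1 := headIdx_div j i a
  rw [h] at h1
  have h2 := tailIdx_div j i' a'
  have := a.2
  omega

theorem blockHead_ofFn (j : ℕ) (i : Fin 27) (z : Fin (3 ^ (j + 6)) → Z) :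
    blockHead j i (List.ofFn z) = List.ofFn fun a => z (headIdx j i a) := by
  have h1 : (i : ℕ) * 3 ^ (j + 3) ≤ 26 * 3 ^ (j + 3) := Nat.mul_le_mul_right _ (by omega)
  have h2 : 3 ^ (j + 3) = 27 * 3 ^ j := by rw [pow_add]; ring
  have h3 : 3 ^ (j + 6) = 729 * 3 ^ j := by rw [pow_add]; ring
  refine List.ext_getElem ?_ fun n hn hn' => ?_
  · simp only [blockHead, List.length_take, List.length_drop, List.length_ofFn]
    omega
  · simp [blockHead, headIdx]

theorem blockTail_ofFn (j : ℕ) (i : Fin 27) (z : Fin (3 ^ (j + 6)) → Z) :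
    blockTail j i (List.ofFn z) = List.ofFn fun a => z (tailIdx j i a) := by
  have h1 : (i : ℕ) * 3 ^ (j + 3) ≤ 26 * 3 ^ (j + 3) := Nat.mul_le_mul_right _ (by omega)
  have h2 : 3 ^ (j + 3) = 27 * 3 ^ j := by rw [pow_add]; ring
  have h3 : 3 ^ (j + 6) = 729 * 3 ^ j := by rw [pow_add]; ring
  refine List.ext_getElem ?_ fun n hn hn' => ?_
  · simp only [blockTail, List.length_take, List.length_drop, List.length_ofFn]
    omega
  · simp [blockTail, tailIdx, add_assoc]

theorem mem_split_add_six {j : ℕ} (i : Fin 27) {S T S' : List Z}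
    (h : S' ∈ split j (blockHead j i S) (blockTail j i S ++ T)) : S' ∈ split (j + 6) S T := by
  rw [split_add_six, List.mem_flatMap]
  exact ⟨i, List.mem_range.2 i.2, h⟩

end Split

/-! ### Error counts and the VC dimension of error sets -/

section Errors

variable {X : Type*}

theorem errCount_le_of_sublist (h : Hypothesis X) {S T : List (Example X)} (hST : S.Sublist T) :
    errCount h S ≤ errCount h T :=
  hST.countP_le

theorem errCount_ofFn (h : Hypothesis X) {n : ℕ} (z : Fin n → Example X) :
    errCount h (List.ofFn z) = (Finset.univ.filter fun i => h (z i).1 ≠ (z i).2).card := by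
  rw [errCount, List.ofFn_eq_map, List.countP_map, Finset.card_def, Finset.filter_val,
    ← Multiset.countP_eq_card_filter]
  exact (Multiset.coe_countP _ _).symm

theorem IsERM.errCount_le {H : Set (Hypothesis X)} {A : Learner X} (hA : IsERM H A)
    {h : Hypothesis X} (hh : h ∈ H) (S : List (Example X)) : errCount (A S) S ≤ errCount h S := by
  -- On the empty sequence empirical errors are 0/0 = 0 and carry no information, but both counts
  -- vanish.
  rcases S.eq_nil_or_concat with rfl | ⟨S', a, rfl⟩
  · simp [errCount]
  · have h1 := (hA (S' ++ [a])).2 h hh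
    have hpos : (0 : ℝ) < ((S' ++ [a]).length : ℝ) := by
      simp only [List.length_append, List.length_singleton]
      positivity
    rw [empError, empError, div_le_div_iff_of_pos_right hpos] at h1
    rw [List.concat_eq_append]
    exact_mod_cast h1

/-- The largest number of errors of `h` on a member of the family of the splitting scheme. -/
def maxErr (h : Hypothesis X) (k : ℕ) (S T : List (Example X)) : ℕ :=
  ((split k S T).map (errCount h)).foldr max 0

theorem le_foldr_max {l : List ℕ} {a : ℕ} (h : a ∈ l) : a ≤ l.foldr max 0 := by
  induction l with
  | nil => simp at h
  | cons b l ih =>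
    rcases List.mem_cons.1 h with rfl | h
    · exact le_max_left _ _
    · exact (ih h).trans (le_max_right _ _)

theorem foldr_max_le {l : List ℕ} {b : ℕ} (h : ∀ a ∈ l, a ≤ b) : l.foldr max 0 ≤ b := by
  induction l with
  | nil => simp
  | cons a l ih =>
    exact max_le (h a List.mem_cons_self) (ih fun c hc => h c (List.mem_cons_of_mem a hc))

theorem errCount_le_maxErr (h : Hypothesis X) {k : ℕ} {S T S' : List (Example X)}
    (hS : S' ∈ split k S T) : errCount h S' ≤ maxErr h k S T :=
  le_foldr_max (List.mem_map_of_mem hS)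

theorem maxErr_le (h : Hypothesis X) {k : ℕ} {S T : List (Example X)} {b : ℕ}
    (hb : ∀ S' ∈ split k S T, errCount h S' ≤ b) : maxErr h k S T ≤ b :=
  foldr_max_le (by simpa using hb)

theorem maxErr_block_le (h : Hypothesis X) {j : ℕ} (i : Fin 27) (S T : List (Example X)) :
    maxErr h j (blockHead j i S) (blockTail j i S ++ T) ≤ maxErr h (j + 6) S T :=
  maxErr_le h fun _ hS => errCount_le_maxErr h (mem_split_add_six i hS)

/-- The recursion keeps its passive sequence as a suffix of every training sequence, so the tail is
contained in each of them and its errors are counted there. -/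
theorem IsERM.errCount_blockTail_le {H : Set (Hypothesis X)} {A : Learner X} (hA : IsERM H A)
    {h : Hypothesis X} (hh : h ∈ H) {j : ℕ} (i : Fin 27) {S T S' : List (Example X)}
    (hS : S' ∈ split j (blockHead j i S) (blockTail j i S ++ T)) :
    errCount (A S') (blockTail j i S) ≤ maxErr h (j + 6) S T :=
  calc errCount (A S') (blockTail j i S)
      ≤ errCount (A S') S' := errCount_le_of_sublist _
        ((List.sublist_append_left _ _).trans (suffix_of_mem_split hS).sublist)
    _ ≤ errCount h S' := hA.errCount_le hh S'
    _ ≤ maxErr h (j + 6) S T := errCount_le_maxErr h (mem_split_add_six i hS)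

/-- One hypothesis errs on the whole shattered set; with two labels this fixes the label of each
point, so the set projects injectively to `X`. Error patterns then correspond to labellings. -/
theorem VCBound.of_vcDim {H : Set (Hypothesis X)} {d : ℕ} (hd : vcDim H = d) (R : Set (Example X)) :
    VCBound {c | ∃ h ∈ H, c = R ∩ {z | h z.1 ≠ z.2}} d := by
  classical
  intro w hw
  have hwR : ∀ x ∈ w, x ∈ R := by
    obtain ⟨c, ⟨h, -, rfl⟩, hc⟩ := hw w subset_rfl
    exact fun x hx => ((hc x hx).2 hx).1
  have hne : ∀ t ⊆ w, ∃ h ∈ H, ∀ z ∈ w, h z.1 ≠ z.2 ↔ z ∈ t := by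
    intro t ht
    obtain ⟨c, ⟨h, hh, rfl⟩, hc⟩ := hw t ht
    refine ⟨h, hh, fun z hz => ?_⟩
    rw [← hc z hz]
    simp [hwR z hz]
  have huu : ∀ a b c : Label, a ≠ b → a ≠ c → b = c := by decide
  have hinj : Set.InjOn Prod.fst (w : Set (Example X)) := by
    rintro ⟨x, y⟩ hz ⟨x', y'⟩ hz' hxx
    obtain rfl : x = x' := hxx
    obtain ⟨h, -, hh⟩ := hne w subset_rfl
    exact Prod.ext rfl (huu _ _ _ ((hh _ hz).2 hz) ((hh _ hz').2 hz'))
  rw [← Finset.card_image_of_injOn hinj]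
  have hsh : Shatters H (w.image Prod.fst) := by
    intro f
    obtain ⟨h, hh, hhw⟩ := hne (w.filter fun z => f z.1 ≠ z.2) (Finset.filter_subset _ _)
    refine ⟨h, hh, fun x hx => ?_⟩
    obtain ⟨z, hz, rfl⟩ := Finset.mem_image.1 hx
    have h1 := hhw z hz
    rw [Finset.mem_filter] at h1
    by_cases hf : f z.1 ≠ z.2
    · exact huu z.2 _ _ (h1.2 ⟨hz, hf⟩).symm hf.symm
    · have : ¬ h z.1 ≠ z.2 := fun hc => hf (h1.1 hc).2
      rw [not_not] at this hf
      rw [this, hf]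
  have := le_iSup (fun s : {s : Finset X // Shatters H s} => (s.1.card : ℕ∞)) ⟨_, hsh⟩
  have h2 : ((w.image Prod.fst).card : ℕ∞) ≤ d := by
    rw [← hd]
    exact this
  exact_mod_cast h2

end Errors

/-! ### Measurability of ensembles and error counts -/

section Measurability

variable {X Ω : Type*} [MeasurableSpace X] [MeasurableSpace Ω]

theorem measurableSet_err {h : Ω → Hypothesis X} (hh : Measurable fun p : Ω × X => h p.1 p.2) :
    MeasurableSet {p : Ω × Example X | h p.1 p.2.1 ≠ p.2.2} :=
  (measurableSet_eq_fun (hh.comp (measurable_fst.prodMk (measurable_fst.comp measurable_snd)))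
    (measurable_snd.comp measurable_snd)).compl

theorem measurable_countP {L : List (Ω → Hypothesis X)}
    (hL : ∀ h ∈ L, Measurable fun p : Ω × X => h p.1 p.2) :
    Measurable fun p : Ω × Example X =>
      (((L.map fun h => h p.1).countP fun h => h p.2.1 ≠ p.2.2 : ℕ) : ℝ) := by
  induction L with
  | nil => simp
  | cons h L ih =>
    simp only [List.map_cons, List.countP_cons, Nat.cast_add, Nat.cast_ite, Nat.cast_one,
      Nat.cast_zero, decide_eq_true_eq]
    exact (ih fun g hg => hL g (List.mem_cons_of_mem h hg)).add (Measurable.ite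
      (measurableSet_err (hL h List.mem_cons_self)) measurable_const measurable_const)

theorem measurable_avgErr {L : List (Ω → Hypothesis X)}
    (hL : ∀ h ∈ L, Measurable fun p : Ω × X => h p.1 p.2) :
    Measurable fun p : Ω × Example X => avgErr (L.map fun h => h p.1) p.2 := by
  simp only [avgErr, List.length_map]
  exact (measurable_countP hL).div_const _

theorem measurable_avgErr_const {L : List (Hypothesis X)} (hL : ∀ h ∈ L, Measurable h) :
    Measurable (avgErr L) := by
  have h := measurable_avgErr (Ω := Unit) (L := L.map fun h _ => h) (by
    intro g hg
    obtain ⟨h, hh, rfl⟩ := List.mem_map.1 hg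
    exact (hL h hh).comp measurable_snd)
  have h2 := h.comp (measurable_prodMk_left (x := ()))
  simpa [Function.comp_def] using h2

theorem measurable_ensembleError (D : Measure (Example X)) [IsProbabilityMeasure D] (α : ℝ)
    {L : List (Ω → Hypothesis X)} (hL : ∀ h ∈ L, Measurable fun p : Ω × X => h p.1 p.2) :
    Measurable fun ω => ensembleError D α (L.map fun h => h ω) :=
  (measurable_measure_prodMk_left (measurableSet_le measurable_const
    (measurable_avgErr hL))).ennreal_toReal

theorem measurable_foldr_max {L : List (Ω → ℕ)} (hL : ∀ f ∈ L, Measurable f) :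
    Measurable fun ω => (L.map fun f => f ω).foldr max 0 := by
  induction L with
  | nil => simp
  | cons f L ih =>
    exact (hL f List.mem_cons_self).max (ih fun g hg => hL g (List.mem_cons_of_mem f hg))

theorem measurable_errCount {h : Hypothesis X} (hh : Measurable h) {fs : List (Ω → Example X)}
    (hfs : ∀ f ∈ fs, Measurable f) : Measurable fun ω => errCount h (fs.map fun f => f ω) := by
  induction fs with
  | nil => simp [errCount]
  | cons f fs ih =>
    have hf := hfs f List.mem_cons_self
    simp only [errCount, List.map_cons, List.countP_cons, decide_eq_true_eq]
    refine Measurable.add (ih fun g hg => hfs g (List.mem_cons_of_mem f hg))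
      (Measurable.ite ?_ measurable_const measurable_const)
    exact (measurableSet_eq_fun (hh.comp hf.fst) hf.snd).compl

theorem IsMeasurableLearner.measurable_map {A : Learner X} (hA : IsMeasurableLearner A)
    {fs : List (Ω → Example X)} (hfs : ∀ f ∈ fs, Measurable f) :
    Measurable fun p : Ω × X => A (fs.map fun f => f p.1) p.2 := by
  have h : Measurable fun p : Ω × X => ((fun i : Fin fs.length => fs.get i p.1), p.2) := by
    refine Measurable.prodMk (measurable_pi_lambda _ fun i => ?_) measurable_snd
    exact (hfs _ (List.get_mem fs i)).comp measurable_fst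
  have e : (fun p : Ω × X => A (fs.map fun f => f p.1) p.2) =
      fun p => A (List.ofFn fun i : Fin fs.length => fs.get i p.1) p.2 := by
    funext p
    have e' : fs.map (fun f => f p.1) = List.ofFn fun i : Fin fs.length => fs.get i p.1 :=
      List.ext_getElem (by simp) fun n hn hn' => by simp
    rw [e']
  rw [e]
  exact (hA fs.length).comp h

/-- The hypotheses that the learner outputs along the splitting scheme, as functions of the
randomness on which the entries of the training sequence depend. -/
def ensembleFun {Ω X : Type*} (A : Learner X) (k : ℕ) (fs ts : List (Ω → Example X)) :
    List (Ω → Hypothesis X) :=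
  (split k fs ts).map fun S ω => A (S.map fun f => f ω)

theorem ensemble_map {Ω X : Type*} (A : Learner X) (k : ℕ) (fs ts : List (Ω → Example X)) (ω : Ω) :
    ensemble A k (fs.map fun f => f ω) (ts.map fun f => f ω) =
      (ensembleFun A k fs ts).map fun h => h ω := by
  rw [ensemble, split_map, ensembleFun, List.map_map, List.map_map]
  rfl

theorem IsMeasurableLearner.measurable_ensembleFun {A : Learner X} (hA : IsMeasurableLearner A)
    {k : ℕ} {fs ts : List (Ω → Example X)} (hfs : ∀ f ∈ fs, Measurable f)
    (hts : ∀ f ∈ ts, Measurable f) :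
    ∀ h ∈ ensembleFun A k fs ts, Measurable fun p : Ω × X => h p.1 p.2 := by
  intro h hh
  obtain ⟨S, hS, rfl⟩ := List.mem_map.1 hh
  exact hA.measurable_map fun f hf => (mem_of_mem_split hS hf).elim (hfs f) (hts f)

theorem measurable_maxErr {h : Hypothesis X} (hh : Measurable h) {k : ℕ}
    {fs ts : List (Ω → Example X)} (hfs : ∀ f ∈ fs, Measurable f) (hts : ∀ f ∈ ts, Measurable f) :
    Measurable fun ω => maxErr h k (fs.map fun f => f ω) (ts.map fun f => f ω) := by
  have := measurable_foldr_max
    (L := (split k fs ts).map fun S ω => errCount h (S.map fun f => f ω)) (by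
    intro g hg
    obtain ⟨S, hS, rfl⟩ := List.mem_map.1 hg
    exact measurable_errCount hh fun f hf => (mem_of_mem_split hS hf).elim (hfs f) (hts f))
  simpa [maxErr, split_map, List.map_map, Function.comp_def] using this

end Measurability

/-! ### From pairs of ensembles to their union -/

section Aggregation

variable {X : Type*}

theorem avgErr_nonneg (L : List (Hypothesis X)) (z : Example X) : 0 ≤ avgErr L z := by
  unfold avgErr
  positivity

theorem avgErr_le_one (L : List (Hypothesis X)) (z : Example X) : avgErr L z ≤ 1 := by
  unfold avgErr
  exact div_le_one_of_le₀ (by exact_mod_cast List.countP_le_length) (by positivity)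

theorem avgErr_flatMap {L : ℕ → List (Hypothesis X)} {n q : ℕ} (hq : ∀ i < n, (L i).length = q)
    (z : Example X) :
    avgErr ((List.range n).flatMap L) z = (∑ i : Fin n, avgErr (L i) z) / n := by
  have hlen : ((List.range n).flatMap L).length = n * q := by
    rw [List.length_flatMap, List.map_congr_left (g := fun _ => q)
      (by simpa using hq)]
    simp
  have hcount : ((List.range n).flatMap L).countP (fun h => h z.1 ≠ z.2) =
      ∑ i : Fin n, (L i).countP fun h => h z.1 ≠ z.2 := by
    rw [List.countP_flatMap, ← Finset.sum_range fun i => (L i).countP fun h => h z.1 ≠ z.2]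
    rfl
  rw [avgErr, hlen, hcount]
  simp only [avgErr, hq _ (Fin.is_lt _)]
  rw [← Finset.sum_div, div_div]
  push_cast
  rw [mul_comm]

/-- Some `a i` is at least the mean 10/243; as `a i ≤ 1`, the remaining terms sum to at least 1/9.
-/
theorem one_le_sum_mul_of_le_sum {a : Fin 27 → ℝ} (h0 : ∀ i, 0 ≤ a i) (h1 : ∀ i, a i ≤ 1)
    (h : 10 / 9 ≤ ∑ i, a i) :
    1 ≤ 9 * ∑ i, ∑ j ∈ Finset.univ.erase i, (if 10 / 243 ≤ a i then a j else 0) := by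
  obtain ⟨i, hi⟩ : ∃ i, 10 / 243 ≤ a i := by
    by_contra! hc
    have : ∑ i, a i < ∑ _i : Fin 27, (10 / 243 : ℝ) :=
      Finset.sum_lt_sum_of_nonempty Finset.univ_nonempty fun i _ => hc i
    norm_num at this
    linarith
  have h2 := Finset.add_sum_erase Finset.univ a (Finset.mem_univ i)
  have h3 : ∑ j ∈ Finset.univ.erase i, (if 10 / 243 ≤ a i then a j else 0) ≤
      ∑ i, ∑ j ∈ Finset.univ.erase i, (if 10 / 243 ≤ a i then a j else 0) := by
    refine Finset.single_le_sum
      (f := fun i => ∑ j ∈ Finset.univ.erase i, (if 10 / 243 ≤ a i then a j else 0))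
      (fun i _ => Finset.sum_nonneg fun j _ => ?_) (Finset.mem_univ i)
    split_ifs
    exacts [h0 j, le_rfl]
  simp only [hi, if_true] at h3
  linarith [h1 i]

variable [MeasurableSpace X] (D : Measure (Example X)) [IsProbabilityMeasure D]

theorem integrable_avgErr {L : List (Hypothesis X)} (hL : ∀ h ∈ L, Measurable h) :
    Integrable (avgErr L) D :=
  Integrable.of_bound (measurable_avgErr_const hL).aestronglyMeasurable 1
    (Filter.Eventually.of_forall fun z => by
      rw [Real.norm_of_nonneg (avgErr_nonneg L z)]
      exact avgErr_le_one L z)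

theorem setIntegral_avgErr_le {L : List (Hypothesis X)} (hL : ∀ h ∈ L, Measurable h)
    {R : Set (Example X)} {Q : ℝ} (hQ0 : 0 ≤ Q)
    (hQ : ∀ h ∈ L, D.real (R ∩ {z | h z.1 ≠ z.2}) ≤ Q) : ∫ z in R, avgErr L z ∂D ≤ Q := by
  have key : ∫ z in R, (L.countP fun h => h z.1 ≠ z.2 : ℝ) ∂D ≤ L.length * Q ∧
      Integrable (fun z => (L.countP fun h => h z.1 ≠ z.2 : ℝ)) (D.restrict R) := by
    clear hQ0
    induction L with
    | nil => simp
    | cons h L ih =>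
      obtain ⟨ih1, ih2⟩ := ih (fun g hg => hL g (List.mem_cons_of_mem h hg))
        (fun g hg => hQ g (List.mem_cons_of_mem h hg))
      have hE : MeasurableSet {z : Example X | h z.1 ≠ z.2} :=
        (measurableSet_eq_fun ((hL h List.mem_cons_self).comp measurable_fst)
          measurable_snd).compl
      have hi : Integrable ({z : Example X | h z.1 ≠ z.2}.indicator fun _ => (1 : ℝ))
          (D.restrict R) := (integrable_const 1).indicator hE
      have heq : ∀ z : Example X, ((h :: L).countP (fun h => h z.1 ≠ z.2) : ℝ) =
          (L.countP fun h => h z.1 ≠ z.2 : ℝ) +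
            {z : Example X | h z.1 ≠ z.2}.indicator (fun _ => (1 : ℝ)) z := by
        intro z
        by_cases hz : h z.1 = z.2 <;> simp [hz]
      simp_rw [heq]
      refine ⟨?_, ih2.add hi⟩
      rw [integral_add ih2 hi, integral_indicator_const _ hE, measureReal_restrict_apply hE,
        Set.inter_comm]
      have := hQ h List.mem_cons_self
      simp only [List.length_cons, smul_eq_mul, mul_one]
      push_cast
      linarith
  simp only [avgErr]
  rw [integral_div]
  -- For the empty list the average is 0/0 = 0, which is where `0 ≤ Q` enters.
  rcases eq_or_ne L [] with rfl | hne
  · simpa using hQ0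
  · rw [div_le_iff₀' (by exact_mod_cast List.length_pos_of_ne_nil hne)]
    exact key.1

/-- The error of the union of 27 ensembles, in terms of the errors of the members of one ensemble
on the region where another ensemble is bad. -/
theorem ensembleError_flatMap_le {L : ℕ → List (Hypothesis X)} {q : ℕ}
    (hq : ∀ i < 27, (L i).length = q) (hL : ∀ i : Fin 27, ∀ h ∈ L i, Measurable h) {Q : ℝ}
    (hQ0 : 0 ≤ Q) (hQ : ∀ i j : Fin 27, i ≠ j → ∀ h ∈ L j,
      D.real ({z | 10 / 243 ≤ avgErr (L i) z} ∩ {z | h z.1 ≠ z.2}) ≤ Q) :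
    ensembleError D (10 / 243) ((List.range 27).flatMap L) ≤ 6318 * Q := by
  have hRm : ∀ i : Fin 27, MeasurableSet {z | 10 / 243 ≤ avgErr (L i) z} := fun i =>
    measurableSet_le measurable_const (measurable_avgErr_const (hL i))
  have hflat : ∀ h ∈ (List.range 27).flatMap L, Measurable h := by
    intro h hh
    obtain ⟨i, hi, hh⟩ := List.mem_flatMap.1 hh
    exact hL ⟨i, List.mem_range.1 hi⟩ h hh
  have hBm : MeasurableSet {z | 10 / 243 ≤ avgErr ((List.range 27).flatMap L) z} :=
    measurableSet_le measurable_const (measurable_avgErr_const hflat)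
  have hint : ∀ i j : Fin 27, Integrable
      ({z | 10 / 243 ≤ avgErr (L i) z}.indicator (avgErr (L j))) D := fun i j =>
    (integrable_avgErr D (hL j)).indicator (hRm i)
  calc ensembleError D (10 / 243) ((List.range 27).flatMap L)
      = ∫ z, {z | 10 / 243 ≤ avgErr ((List.range 27).flatMap L) z}.indicator
          (fun _ => (1 : ℝ)) z ∂D := by
        rw [integral_indicator_const _ hBm, smul_eq_mul, mul_one]
        rfl
    _ ≤ ∫ z, 9 * ∑ i : Fin 27, ∑ j ∈ Finset.univ.erase i,
          {z | 10 / 243 ≤ avgErr (L i) z}.indicator (avgErr (L j)) z ∂D := by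
        refine integral_mono ((integrable_const 1).indicator hBm)
          ((integrable_finsetSum _ fun i _ => integrable_finsetSum _ fun j _ =>
            hint i j).const_mul 9) fun z => ?_
        simp only [Set.indicator_apply, Set.mem_ofPred_eq]
        split_ifs with hz
        · rw [avgErr_flatMap hq] at hz
          refine one_le_sum_mul_of_le_sum (fun i => avgErr_nonneg (L i) z)
            (fun i => avgErr_le_one (L i) z) ?_
          norm_num at hz
          linarith
        · refine mul_nonneg (by norm_num) (Finset.sum_nonneg fun i _ =>
            Finset.sum_nonneg fun j _ => ?_)
          split_ifs
          exacts [avgErr_nonneg _ _, le_rfl]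
    _ = 9 * ∑ i : Fin 27, ∑ j ∈ Finset.univ.erase i,
          ∫ z in {z | 10 / 243 ≤ avgErr (L i) z}, avgErr (L j) z ∂D := by
        rw [integral_const_mul, integral_finsetSum _ fun i _ =>
          integrable_finsetSum _ fun j _ => hint i j]
        congr 1
        refine Finset.sum_congr rfl fun i _ => ?_
        rw [integral_finsetSum _ fun j _ => hint i j]
        exact Finset.sum_congr rfl fun j _ => integral_indicator (hRm i)
    _ ≤ 9 * ∑ i : Fin 27, ∑ j ∈ Finset.univ.erase i, Q := by
        gcongr with i _ j hj
        exact setIntegral_avgErr_le D (hL j) hQ0 (hQ i j (Finset.ne_of_mem_erase hj).symm)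
    _ = 6318 * Q := by
        simp [Finset.card_erase_of_mem]
        ring

end Aggregation

/-! ### Failure events and their probabilities -/

section Induction

theorem measure_prod_le_of_forall {Ω Y : Type*} [MeasurableSpace Ω] [MeasurableSpace Y]
    (ν : Measure Ω) [IsProbabilityMeasure ν] (μ : Measure Y) [IsProbabilityMeasure μ]
    {B : Set (Ω × Y)} (hB : MeasurableSet B) {ε : ℝ≥0∞}
    (h : ∀ ω, μ (Prod.mk ω ⁻¹' B) ≤ ε) : (ν.prod μ) B ≤ ε := by
  rw [Measure.prod_apply hB]
  exact (lintegral_mono h).trans (by simp)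

variable {X : Type*} [MeasurableSpace X]

/-- The event that the bound on the ensemble error fails. -/
def FailsBound (D : Measure (Example X)) (A : Learner X) (h : Hypothesis X) (c : ℝ) (k : ℕ)
    (b : ℝ) (S T : List (Example X)) : Prop :=
  c * (maxErr h k S T + b) < 3 ^ k * ensembleError D (10 / 243) (ensemble A k S T)

/-- The event that some member of an ensemble trained on block `j` has many errors, in comparison
with its empirical errors, where the ensemble trained on block `i` is bad. -/
def FailsPair (D : Measure (Example X)) (A : Learner X) (d : ℕ) (ρ L : ℝ) (k : ℕ) (i j : Fin 27)
    (S T : List (Example X)) : Prop :=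
  ∃ g ∈ ensemble A k (blockHead k j S) (blockTail k j S ++ T),
    (errCount g (blockTail k j S) : ℝ) + d * Real.log ρ + 2 * (26 * 3 ^ k) *
      ensembleError D (10 / 243) (ensemble A k (blockHead k i S) (blockTail k i S ++ T)) / ρ + L <
    (26 * 3 ^ k) * D.real ({z | 10 / 243 ≤
      avgErr (ensemble A k (blockHead k i S) (blockTail k i S ++ T)) z} ∩ {z | g z.1 ≠ z.2}) / 3

variable {D : Measure (Example X)} [IsProbabilityMeasure D] {A : Learner X} {h : Hypothesis X}

theorem measurable_of_mem_ofFn {Ω Z : Type*} [MeasurableSpace Ω] [MeasurableSpace Z] {n : ℕ}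
    {f : Fin n → Ω → Z} (hf : ∀ a, Measurable (f a)) : ∀ g ∈ List.ofFn f, Measurable g := by
  intro g hg
  obtain ⟨a, rfl⟩ := List.mem_ofFn.1 hg
  exact hf a

theorem measurable_of_mem_append_const {Ω Z : Type*} [MeasurableSpace Ω] [MeasurableSpace Z]
    {fs : List (Ω → Z)} (hfs : ∀ f ∈ fs, Measurable f) (T : List Z) :
    ∀ g ∈ fs ++ T.map fun t _ => t, Measurable g := by
  intro g hg
  rcases List.mem_append.1 hg with hg | hg
  · exact hfs g hg
  · obtain ⟨t, -, rfl⟩ := List.mem_map.1 hg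
    exact measurable_const

theorem map_apply_ofFn {Ω Z : Type*} {n : ℕ} (f : Fin n → Ω → Z) (ω : Ω) :
    (List.ofFn f).map (fun g => g ω) = List.ofFn fun a => f a ω := by
  simp [List.map_ofFn, Function.comp_def]

theorem map_apply_append_const {Ω Z : Type*} (fs : List (Ω → Z)) (T : List Z) (ω : Ω) :
    (fs ++ T.map fun t (_ : Ω) => t).map (fun g : Ω → Z => g ω) = (fs.map fun g => g ω) ++ T := by
  simp [Function.comp_def]

theorem measurableSet_failsBound {Ω : Type*} [MeasurableSpace Ω] (hA : IsMeasurableLearner A)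
    (hh : Measurable h) (c : ℝ) (k : ℕ) (b : ℝ) {fs ts : List (Ω → Example X)}
    (hfs : ∀ f ∈ fs, Measurable f) (hts : ∀ f ∈ ts, Measurable f) :
    MeasurableSet {ω | FailsBound D A h c k b (fs.map fun f => f ω) (ts.map fun f => f ω)} := by
  simp only [FailsBound, ensemble_map]
  have m1 : Measurable fun ω =>
      (maxErr h k (fs.map fun f => f ω) (ts.map fun f => f ω) : ℝ) :=
    measurable_from_top.comp (measurable_maxErr hh hfs hts)
  exact measurableSet_lt ((m1.add_const _).const_mul _)
    ((measurable_ensembleError D _ (hA.measurable_ensembleFun hfs hts)).const_mul _)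

/-- Conditionally on the entries read by `e`, the passive sequence is fixed and the entries read by
`e'` are a fresh sample. Hence the need for `hk` at every passive sequence. -/
theorem measure_failsBound_precomp_le (hA : IsMeasurableLearner A) (hh : Measurable h) {c : ℝ}
    {k n n' : ℕ} {b : ℝ} {ε : ℝ≥0∞} {T : List (Example X)}
    (hk : ∀ T, (Measure.pi fun _ : Fin n => D)
      {z | FailsBound D A h c k b (List.ofFn z) T} ≤ ε) {τ : Type*} [Fintype τ]
    {e : Fin n' → τ} {e' : Fin n → τ} (he : Function.Injective e) (he' : Function.Injective e')
    (hee' : ∀ a b, e a ≠ e' b) :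
    (Measure.pi fun _ : τ => D) {z | FailsBound D A h c k b
      (List.ofFn fun a => z (e' a)) ((List.ofFn fun a => z (e a)) ++ T)} ≤ ε := by
  have hmp := measurePreserving_precomp_prod D he he' hee'
  have hB : MeasurableSet {p : (Fin n' → Example X) × (Fin n → Example X) |
      FailsBound D A h c k b (List.ofFn p.2) (List.ofFn p.1 ++ T)} := by
    have := measurableSet_failsBound (D := D) hA hh c k b
      (measurable_of_mem_ofFn (f := fun a
        (p : (Fin n' → Example X) × (Fin n → Example X)) => p.2 a) fun a => by fun_prop)
      (measurable_of_mem_append_const (measurable_of_mem_ofFn (f := fun a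
        (p : (Fin n' → Example X) × (Fin n → Example X)) => p.1 a) fun a => by fun_prop) T)
    simpa only [map_apply_append_const, map_apply_ofFn] using this
  have hle := measure_prod_le_of_forall (Measure.pi fun _ : Fin n' => D)
    (Measure.pi fun _ : Fin n => D) hB fun ω => hk (List.ofFn ω ++ T)
  rw [← hmp.measure_preimage hB.nullMeasurableSet] at hle
  exact hle

theorem measure_failsBound_block_le (hA : IsMeasurableLearner A) (hh : Measurable h) {c : ℝ}
    {k : ℕ} {b : ℝ} {ε : ℝ≥0∞} {T : List (Example X)}
    (hk : ∀ T, (Measure.pi fun _ : Fin (3 ^ k) => D)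
      {z | FailsBound D A h c k b (List.ofFn z) T} ≤ ε) (i : Fin 27) :
    (Measure.pi fun _ : Fin (3 ^ (k + 6)) => D) {z | FailsBound D A h c k b
      (blockHead k i (List.ofFn z)) (blockTail k i (List.ofFn z) ++ T)} ≤ ε := by
  simp only [blockHead_ofFn, blockTail_ofFn]
  exact measure_failsBound_precomp_le hA hh hk
    (fun a a' haa => (tailIdx_inj.1 haa).2) (fun a a' haa => (headIdx_inj.1 haa).2)
    (fun a b => (headIdx_ne_tailIdx k i i b a).symm)

/-- `Ω` determines the region and the active entries; the fresh points enter training only through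
the passive part. The trained hypotheses depend on those points, so the bound must be uniform over
`H`. They are finitely many measurable selections, so no supremum over `H` has to be measurable. -/
theorem measure_exists_mem_ensemble_le {Ω : Type*} [MeasurableSpace Ω] (ν : Measure Ω)
    [IsProbabilityMeasure ν] {H : Set (Hypothesis X)} {d : ℕ} (hd : vcDim H = d)
    (hAH : ∀ S, A S ∈ H) (hA : IsMeasurableLearner A) {ρ : ℝ} (hρ : 1 ≤ ρ) (L α : ℝ) (k n : ℕ)
    {G : List (Ω → Hypothesis X)} (hG : ∀ g ∈ G, Measurable fun p : Ω × X => g p.1 p.2)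
    {fs : List (Ω → Example X)} (hfs : ∀ f ∈ fs, Measurable f) (T : List (Example X)) :
    (ν.prod (Measure.pi fun _ : Fin n => D)) {p |
      ∃ g ∈ ensemble A k (fs.map fun f => f p.1) (List.ofFn p.2 ++ T),
        (errCount g (List.ofFn p.2) : ℝ) + d * Real.log ρ +
          2 * n * ensembleError D α (G.map fun g => g p.1) / ρ + L <
        n * D.real ({z | α ≤ avgErr (G.map fun g => g p.1) z} ∩ {z | g z.1 ≠ z.2}) / 3} ≤
      ENNReal.ofReal (Real.exp (-L)) := by
  classical
  have hfs' : ∀ f ∈ fs.map fun f (p : Ω × (Fin n → Example X)) => f p.1, Measurable f := by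
    intro f hf
    obtain ⟨f', hf', rfl⟩ := List.mem_map.1 hf
    exact (hfs f' hf').comp measurable_fst
  have hts := measurable_of_mem_append_const (measurable_of_mem_ofFn (f := fun a
      (p : Ω × (Fin n → Example X)) => p.2 a) fun a => by fun_prop) T
  have hK := hA.measurable_ensembleFun (k := k) hfs' hts
  have heq : ∀ p : Ω × (Fin n → Example X),
      ensemble A k (fs.map fun f => f p.1) (List.ofFn p.2 ++ T) =
      (ensembleFun A k (fs.map fun f (p : Ω × (Fin n → Example X)) => f p.1)
        ((List.ofFn fun a (p : Ω × (Fin n → Example X)) => p.2 a) ++ T.map fun t _ => t)).map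
        fun g => g p := by
    intro p
    rw [← ensemble_map, map_apply_append_const, map_apply_ofFn, List.map_map]
    rfl
  generalize hKdef : ensembleFun A k (fs.map fun f (p : Ω × (Fin n → Example X)) => f p.1)
    ((List.ofFn fun a (p : Ω × (Fin n → Example X)) => p.2 a) ++ T.map fun t _ => t) = K at hK heq
  have hKH : ∀ g ∈ K, ∀ p, g p ∈ H := by
    intro g hg p
    rw [← hKdef] at hg
    obtain ⟨S, -, rfl⟩ := List.mem_map.1 hg
    exact hAH _
  have hR : MeasurableSet {p : Ω × Example X | p.2 ∈
      {z | α ≤ avgErr (G.map fun g => g p.1) z}} :=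
    measurableSet_le measurable_const (measurable_avgErr hG)
  have hmain := measure_prod_exists_lt_le ν D (κ := Fin n) (ι := Fin K.length)
    (C := fun ω => {c | ∃ g ∈ H, c = {z | α ≤ avgErr (G.map fun g => g ω) z} ∩
      {z | g z.1 ≠ z.2}})
    (E := fun l p => {z | α ≤ avgErr (G.map fun g => g p.1) z} ∩ {z | K.get l p z.1 ≠ z.2})
    (fun ω => VCBound.of_vcDim hd _) hR
    (fun ω c hc => by obtain ⟨g, -, rfl⟩ := hc; exact Set.inter_subset_left) hρ
    (fun l p => ⟨K.get l p, hKH _ (List.get_mem K l) p, rfl⟩)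
    (fun l => MeasurableSet.inter (hR.preimage
      (f := fun p : (Ω × (Fin n → Example X)) × Example X => (p.1.1, p.2)) (by fun_prop))
      (measurableSet_err (hK _ (List.get_mem K l)))) L
  refine (measure_mono ?_).trans hmain
  rintro ⟨ω, s⟩ ⟨g, hg, hlt⟩
  rw [heq] at hg
  obtain ⟨g', hg', rfl⟩ := List.mem_map.1 hg
  obtain ⟨l, rfl⟩ := List.get_of_mem hg'
  refine ⟨l, lt_of_le_of_lt ?_ (lt_of_lt_of_le hlt ?_)⟩
  · rw [errCount_ofFn, Fintype.card_fin]
    gcongr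
    · exact fun hx => hx.2
    · exact le_rfl
  · rw [Fintype.card_fin]

/-- The region depends on block `i` only. Conditioning on block `i` and the head of block `j` leaves
the tail of `j` as the fresh sample. -/
theorem measure_failsPair_le {H : Set (Hypothesis X)} {d : ℕ} (hd : vcDim H = d)
    (hAH : ∀ S, A S ∈ H) (hA : IsMeasurableLearner A) {ρ : ℝ} (hρ : 1 ≤ ρ) (L : ℝ) (k : ℕ)
    {i j : Fin 27} (hij : i ≠ j) (T : List (Example X)) :
    (Measure.pi fun _ : Fin (3 ^ (k + 6)) => D) {z | FailsPair D A d ρ L k i j (List.ofFn z) T} ≤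
      ENNReal.ofReal (Real.exp (-L)) := by
  have he : Function.Injective (Sum.elim (headIdx k i) (Sum.elim (tailIdx k i) (headIdx k j))) := by
    refine Function.Injective.sumElim (fun a a' haa => (headIdx_inj.1 haa).2)
      (Function.Injective.sumElim (fun a a' haa => (tailIdx_inj.1 haa).2)
        (fun a a' haa => (headIdx_inj.1 haa).2) fun a b => (headIdx_ne_tailIdx k j i b a).symm) ?_
    rintro a (b | b)
    · exact headIdx_ne_tailIdx k i i a b
    · exact fun hab => hij (headIdx_inj.1 hab).1
  have hmp := measurePreserving_precomp_prod D (e' := tailIdx k j) he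
    (fun a a' haa => (tailIdx_inj.1 haa).2) (by
      rintro (a | a | a) b
      · exact headIdx_ne_tailIdx k i j a b
      · exact fun hab => hij (tailIdx_inj.1 hab).1
      · exact headIdx_ne_tailIdx k j j a b)
  have hG := hA.measurable_ensembleFun (k := k)
    (measurable_of_mem_ofFn (f := fun a
      (ω : Fin (3 ^ k) ⊕ Fin (26 * 3 ^ k) ⊕ Fin (3 ^ k) → Example X) => ω (Sum.inl a))
      fun a => by fun_prop)
    (measurable_of_mem_append_const (measurable_of_mem_ofFn (f := fun a
      (ω : Fin (3 ^ k) ⊕ Fin (26 * 3 ^ k) ⊕ Fin (3 ^ k) → Example X) => ω (Sum.inr (Sum.inl a)))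
      fun a => by fun_prop) T)
  have hmain := measure_exists_mem_ensemble_le (D := D)
    (Measure.pi fun _ : Fin (3 ^ k) ⊕ Fin (26 * 3 ^ k) ⊕ Fin (3 ^ k) => D) hd hAH hA hρ L
    (10 / 243) k (26 * 3 ^ k) hG
    (measurable_of_mem_ofFn (f := fun a
      (ω : Fin (3 ^ k) ⊕ Fin (26 * 3 ^ k) ⊕ Fin (3 ^ k) → Example X) => ω (Sum.inr (Sum.inr a)))
      fun a => by fun_prop) T
  simp only [← ensemble_map, map_apply_append_const, map_apply_ofFn, Nat.cast_mul, Nat.cast_pow,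
    Nat.cast_ofNat] at hmain
  simp only [FailsPair, blockHead_ofFn, blockTail_ofFn]
  rw [← hmp.map_eq] at hmain
  exact (le_trans (Measure.le_map_apply hmp.measurable.aemeasurable _) hmain)

end Induction

/-! ### Closing the recursion and the degenerate class -/

section Main

variable {X : Type*}

theorem log_pow_three_le (n : ℕ) : Real.log (3 ^ n) ≤ 2 * n := by
  have := Real.log_le_sub_one_of_pos (show (0 : ℝ) < 3 by norm_num)
  rw [Real.log_pow]
  nlinarith [n.cast_nonneg (α := ℝ)]

/-- Two hypotheses that differ at a point realise both labels there and so shatter it. -/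
theorem eq_of_vcDim_eq_zero {H : Set (Hypothesis X)} (hd : vcDim H = (0 : ℕ)) {g h : Hypothesis X}
    (hg : g ∈ H) (hh : h ∈ H) : g = h := by
  by_contra hne
  obtain ⟨x, hx⟩ := Function.ne_iff.1 hne
  have huu : ∀ a b c : Label, a ≠ b → a = c ∨ b = c := by decide
  have hsh : Shatters H {x} := by
    intro f
    rcases huu _ _ (f x) hx with h1 | h1
    · exact ⟨g, hg, by simpa using h1⟩
    · exact ⟨h, hh, by simpa using h1⟩
  have h1 := le_iSup (fun s : {s : Finset X // Shatters H s} => (s.1.card : ℕ∞)) ⟨_, hsh⟩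
  have h2 : ((1 : ℕ) : ℕ∞) ≤ (0 : ℕ) := by
    rw [← hd]
    exact h1
  simp at h2

/-- For `6 ≤ k` the tail of block 0 serves: it has the proportion 26/729 ≥ 1/29 of the positions,
fixed before the data are seen. -/
theorem exists_sample_mem_split (k : ℕ) : ∃ (n : ℕ) (e : Fin n → Fin (3 ^ k)),
    Function.Injective e ∧ 3 ^ k ≤ 29 * n ∧ ∀ (h : Hypothesis X) (T : List (Example X))
      (z : Fin (3 ^ k) → Example X),
      errCount h (List.ofFn fun a => z (e a)) ≤ maxErr h k (List.ofFn z) T := by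
  induction k using split_induction with
  | base k hk =>
    refine ⟨3 ^ k, id, Function.injective_id, by omega, fun h T z => ?_⟩
    refine le_trans (errCount_le_of_sublist h (List.sublist_append_left _ T))
      (errCount_le_maxErr h ?_)
    rw [split_of_lt hk]
    simp
  | step k _ =>
    refine ⟨26 * 3 ^ k, tailIdx k 0, fun a a' haa => (tailIdx_inj.1 haa).2, ?_, fun h T z => ?_⟩
    · rw [pow_add]
      omega
    · obtain ⟨S', hS'⟩ := List.exists_mem_of_ne_nil _ (split_ne_nil k
        (blockHead k (0 : Fin 27) (List.ofFn z)) (blockTail k (0 : Fin 27) (List.ofFn z) ++ T))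
      rw [← blockTail_ofFn]
      exact (errCount_le_of_sublist h ((List.sublist_append_left _ _).trans
        (suffix_of_mem_split hS').sublist)).trans (errCount_le_maxErr h (mem_split_add_six 0 hS'))

theorem exists_maxErr_eq (h : Hypothesis X) (k : ℕ) (S T : List (Example X)) :
    ∃ S' ∈ split k S T, maxErr h k S T = errCount h S' := by
  by_contra! hc
  have hlt : ∀ S' ∈ split k S T, errCount h S' < maxErr h k S T := fun S' hS' =>
    lt_of_le_of_ne (errCount_le_maxErr h hS') (hc S' hS').symm
  obtain ⟨S', hS'⟩ := List.exists_mem_of_ne_nil _ (split_ne_nil k S T)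
  have h1 := maxErr_le h fun S'' hS'' => Nat.le_pred_of_lt (hlt S'' hS'')
  have h2 := hlt S' hS'
  rw [Nat.pred_eq_sub_one] at h1
  omega

variable [MeasurableSpace X] {D : Measure (Example X)} {A : Learner X} {h : Hypothesis X}

theorem le_iSup_of_not_failsBound {c b : ℝ} (hc : 0 ≤ c) {k : ℕ} {S T : List (Example X)}
    (hS : ¬ FailsBound D A h c k b S T) :
    ensembleError D (10 / 243) (ensemble A k S T) ≤
      (⨆ S' : {S' // S' ∈ split k S T}, c * (errCount h S'.1 : ℝ) / ((3 : ℝ) ^ k / sCap)) +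
        c * b / 3 ^ k := by
  rw [FailsBound, not_lt] at hS
  obtain ⟨S', hS', hmax⟩ := exists_maxErr_eq h k S T
  -- The real supremum of an unbounded family would be 0; finiteness of the index type excludes
  -- this.
  have hfin : Finite {S' // S' ∈ split k S T} := (List.finite_toSet (split k S T)).to_subtype
  have h1 := le_ciSup (f := fun S' : {S' // S' ∈ split k S T} =>
    c * (errCount h S'.1 : ℝ) / ((3 : ℝ) ^ k / sCap)) (Set.finite_range _).bddAbove ⟨S', hS'⟩
  have hs : 1 ≤ sCap := by
    rw [sCap]
    norm_num
  have hpos : (0 : ℝ) < 3 ^ k := by positivity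
  have h2 : c * (maxErr h k S T : ℝ) / 3 ^ k ≤ c * (errCount h S' : ℝ) / ((3 : ℝ) ^ k / sCap) := by
    rw [hmax]
    gcongr
    exact div_le_self hpos.le hs
  calc ensembleError D (10 / 243) (ensemble A k S T)
      ≤ c * (maxErr h k S T + b) / 3 ^ k := by
        rw [le_div_iff₀' hpos]
        exact hS
    _ = c * (maxErr h k S T : ℝ) / 3 ^ k + c * b / 3 ^ k := by rw [mul_add, add_div]
    _ ≤ _ := by
        gcongr
        exact h2.trans h1

variable [IsProbabilityMeasure D]

theorem ensembleError_le_one (α : ℝ) (L : List (Hypothesis X)) : ensembleError D α L ≤ 1 :=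
  measureReal_le_one

/-- One level of the recursion: if no block and no pair of blocks fails, the bound holds. -/
theorem exists_fails_of_failsBound {H : Set (Hypothesis X)} {d : ℕ} (hd : 1 ≤ d)
    (hm : ∀ g ∈ H, Measurable g) (hA : IsERM H A) (hh : h ∈ H) {L : ℝ} (hL : 0 ≤ L) (k : ℕ)
    {S T : List (Example X)} (hS : FailsBound D A h (3 ^ 16) (k + 6) (d + L) S T) :
    ∃ i j : Fin 27, if i = j then
      FailsBound D A h (3 ^ 16) k (d + (L + Real.log (3 ^ 6))) (blockHead k i S)
        (blockTail k i S ++ T)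
      else FailsPair D A d (3 ^ 19) (L + Real.log (3 ^ 6)) k i j S T := by
  by_contra! hc
  set Y : ℕ → List (Hypothesis X) := fun i =>
    ensemble A k (blockHead k i S) (blockTail k i S ++ T)
  set s : ℝ := ((maxErr h (k + 6) S T : ℕ) : ℝ)
  set V : ℝ := s + d + L with hVdef
  set M : ℝ := 3 ^ k
  have hM : 0 < M := by positivity
  have hs : 0 ≤ s := Nat.cast_nonneg _
  have hd' : (1 : ℝ) ≤ d := by exact_mod_cast hd
  -- This uses `1 ≤ d`. It lets V absorb the additive log 3^6 ≤ 12, whence 13V in `hp`.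
  have hV : 1 ≤ V := by linarith
  have hl6 : Real.log (3 ^ 6) ≤ 12 := (log_pow_three_le 6).trans (by norm_num)
  have hl19 : Real.log (3 ^ 19) ≤ 38 := (log_pow_three_le 19).trans (by norm_num)
  have hp : ∀ i : Fin 27, M * ensembleError D (10 / 243) (Y i) ≤ 3 ^ 16 * (13 * V) := by
    intro i
    have h1 := hc i i
    rw [if_pos rfl, FailsBound, not_lt] at h1
    have h2 : (maxErr h k (blockHead k i S) (blockTail k i S ++ T) : ℝ) ≤ s := by
      exact Nat.cast_le.2 (maxErr_block_le h i S T)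
    refine h1.trans ?_
    gcongr
    linarith
  -- 50V bounds s + 38d + L + 12. The region term is 2·26·3^16·13V / 3^19 = 52·13V/27, and 3/26
  -- inverts the factor 26/3 of the tail bound.
  have hq : ∀ i j : Fin 27, i ≠ j → ∀ g ∈ Y j,
      D.real ({z | 10 / 243 ≤ avgErr (Y i) z} ∩ {z | g z.1 ≠ z.2}) ≤
        3 / 26 * (50 * V + 52 * (13 * V) / 27) / M := by
    intro i j hij g hg
    have h1 := hc i j
    rw [if_neg hij, FailsPair] at h1
    push Not at h1
    have h2 := h1 g hg
    have h3 : (errCount g (blockTail k j S) : ℝ) ≤ s := by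
      obtain ⟨S', hS', rfl⟩ := List.mem_map.1 hg
      exact Nat.cast_le.2 (hA.errCount_blockTail_le hh j hS')
    have h4 : (d : ℝ) * Real.log (3 ^ 19) ≤ d * 38 := by gcongr
    have h5 : 2 * (26 * M) * ensembleError D (10 / 243) (Y i) / 3 ^ 19 ≤
        52 * (13 * V) / 27 := by
      rw [div_le_div_iff₀ (by norm_num) (by norm_num)]
      nlinarith [hp i]
    rw [le_div_iff₀ hM]
    change 26 * M * D.real ({z | 10 / 243 ≤ avgErr (Y i) z} ∩ {z | g z.1 ≠ z.2}) / 3 ≤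
      (errCount g (blockTail k j S) : ℝ) + d * Real.log (3 ^ 19) +
      2 * (26 * M) * ensembleError D (10 / 243) (Y i) / 3 ^ 19 + (L + Real.log (3 ^ 6)) at h2
    generalize D.real _ = q at h2 ⊢
    generalize 2 * (26 * M) * ensembleError D (10 / 243) (Y i) / 3 ^ 19 = x at h2 h5
    generalize (errCount g (blockTail k j S) : ℝ) = y at h2 h3
    generalize Real.log (3 ^ 6) = l6 at h2 hl6
    generalize (d : ℝ) * Real.log (3 ^ 19) = l19 at h2 h4
    have h6 : 26 * M * q / 3 ≤ 50 * V + 52 * (13 * V) / 27 := by linarith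
    linarith
  have hlen : ∀ i < 27, (Y i).length = (split k ([] : List (Example X)) []).length := by
    intro i _
    simp only [Y, ensemble, List.length_map]
    exact length_split _ _ _ _ _
  have hYm : ∀ i : Fin 27, ∀ g ∈ Y i, Measurable g := by
    intro i g hg
    obtain ⟨S', -, rfl⟩ := List.mem_map.1 hg
    exact hm _ (hA S').1
  have hfin := ensembleError_flatMap_le D hlen hYm (by positivity) hq
  have hens : ensemble A (k + 6) S T = (List.range 27).flatMap Y := by
    rw [ensemble, split_add_six, List.map_flatMap]
    rfl
  rw [FailsBound, hens, ← add_assoc, pow_add] at hS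
  rw [← mul_div_assoc, le_div_iff₀ hM] at hfin
  -- Since 6318·3/26 = 3^6, the total factor is 3^12·(50 + 676/27) < 3^12·3^4 = 3^16.
  change 3 ^ 16 * V < M * 3 ^ 6 * _ at hS
  linarith

theorem measure_failsBound_le {H : Set (Hypothesis X)} {d : ℕ} (hd : vcDim H = d) (hd1 : 1 ≤ d)
    (hm : ∀ g ∈ H, Measurable g) (hA : IsERM H A) (hAm : IsMeasurableLearner A) (hh : h ∈ H)
    (k : ℕ) {L : ℝ} (hL : 0 ≤ L) (T : List (Example X)) :
    (Measure.pi fun _ : Fin (3 ^ k) => D)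
      {z | FailsBound D A h (3 ^ 16) k (d + L) (List.ofFn z) T} ≤
      ENNReal.ofReal (Real.exp (-L)) := by
  induction k using split_induction generalizing L T with
  | base k hk =>
    -- For short sequences the bound is trivial: 3^k ≤ 3^6 < 3^16·d.
    have : {z : Fin (3 ^ k) → Example X |
        FailsBound D A h (3 ^ 16) k (d + L) (List.ofFn z) T} = ∅ := by
      refine Set.eq_empty_of_forall_notMem fun z hz => ?_
      have hz' : FailsBound D A h (3 ^ 16) k (d + L) (List.ofFn z) T := hz
      rw [FailsBound] at hz'
      have h1 := ensembleError_le_one (D := D) (10 / 243) (ensemble A k (List.ofFn z) T)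
      have h2 : (3 : ℝ) ^ k ≤ 3 ^ 6 := pow_le_pow_right₀ (by norm_num) hk.le
      have h3 : (1 : ℝ) ≤ d := by exact_mod_cast hd1
      have h4 : (0 : ℝ) ≤ maxErr h k (List.ofFn z) T := Nat.cast_nonneg _
      have h5 : (3 : ℝ) ^ k * ensembleError D (10 / 243) (ensemble A k (List.ofFn z) T) ≤
          3 ^ 6 * 1 := by
        gcongr
        exact measureReal_nonneg
      linarith
    rw [this]
    simp
  | step k ih =>
    set L' := L + Real.log (3 ^ 6)
    have hL' : 0 ≤ L' := add_nonneg hL (Real.log_nonneg (by norm_num))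
    set W : Fin 27 × Fin 27 → Set (Fin (3 ^ (k + 6)) → Example X) := fun p =>
      {z | if p.1 = p.2 then FailsBound D A h (3 ^ 16) k (d + L') (blockHead k p.1 (List.ofFn z))
        (blockTail k p.1 (List.ofFn z) ++ T)
        else FailsPair D A d (3 ^ 19) L' k p.1 p.2 (List.ofFn z) T}
    have hW : ∀ p, (Measure.pi fun _ : Fin (3 ^ (k + 6)) => D) (W p) ≤
        ENNReal.ofReal (Real.exp (-L')) := by
      rintro ⟨i, j⟩
      by_cases hij : i = j
      · simp only [W, hij, if_true]
        exact measure_failsBound_block_le hAm (hm h hh) (fun T => ih hL' T) j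
      · simp only [W, hij, if_false]
        exact measure_failsPair_le hd (fun S => (hA S).1) hAm (by norm_num) L' k hij T
    have hsub : {z : Fin (3 ^ (k + 6)) → Example X |
        FailsBound D A h (3 ^ 16) (k + 6) (d + L) (List.ofFn z) T} ⊆ ⋃ p, W p := by
      intro z hz
      obtain ⟨i, j, hij⟩ := exists_fails_of_failsBound hd1 hm hA hh hL k hz
      exact Set.mem_iUnion.2 ⟨(i, j), hij⟩
    refine (measure_mono hsub).trans ((measure_iUnion_fintype_le _ _).trans
      ((Finset.sum_le_sum fun p _ => hW p).trans (le_of_eq ?_)))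
    rw [Finset.sum_const, Finset.card_univ, nsmul_eq_mul, neg_add, Real.exp_add, Real.exp_neg
      (Real.log _), Real.exp_log (by norm_num), ENNReal.ofReal_mul (Real.exp_pos _).le, mul_comm,
      mul_assoc]
    -- The 27² = 3^6 index pairs exactly cancel the factor gained from `L'`.
    have : ENNReal.ofReal ((3 ^ 6 : ℝ)⁻¹) * (Fintype.card (Fin 27 × Fin 27) : ℝ≥0∞) = 1 := by
      rw [← ENNReal.ofReal_natCast, ← ENNReal.ofReal_mul (by positivity)]
      norm_num
    rw [this, mul_one]

/-- Every ensemble member equals `h`, so a deviation bound for the single error set of `h` suffices.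
The recursion does not cover this case, as V may be close to 0. -/
theorem measure_failsBound_le_of_vcDim_eq_zero {H : Set (Hypothesis X)}
    (hd : vcDim H = (0 : ℕ)) (hm : ∀ g ∈ H, Measurable g) (hA : IsERM H A) (hh : h ∈ H)
    (k : ℕ) {L : ℝ} (hL : 0 ≤ L) (T : List (Example X)) :
    (Measure.pi fun _ : Fin (3 ^ k) => D)
      {z | FailsBound D A h (3 ^ 16) k L (List.ofFn z) T} ≤ ENNReal.ofReal (Real.exp (-L)) := by
  classical
  obtain ⟨n, e, he, hn, hcount⟩ := exists_sample_mem_split (X := X) k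
  set R : Set (Example X) := {z | h z.1 ≠ z.2}
  have hR : MeasurableSet R :=
    (measurableSet_eq_fun ((hm h hh).comp measurable_fst) measurable_snd).compl
  have hmain := measure_exists_lt_le (κ := Fin n) (ι := Unit) D (VCBound.of_vcDim hd R) hR
    (fun c hc => by obtain ⟨g, -, rfl⟩ := hc; exact Set.inter_subset_left)
    -- With d = 0 the term d log ρ vanishes; 12 makes 2nP(R)/ρ half of nP(R)/3.
    (ρ := 12) (by norm_num) (E := fun _ _ => R) (fun _ _ => ⟨h, hh, (Set.inter_self R).symm⟩)
    (fun _ => hR.preimage measurable_snd) L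
  rw [← (measurePreserving_precomp D he).map_eq] at hmain
  refine (measure_mono ?_).trans
    ((Measure.le_map_apply (measurePreserving_precomp D he).measurable.aemeasurable _).trans hmain)
  intro z hz
  refine ⟨(), ?_⟩
  have hz' : FailsBound D A h (3 ^ 16) k L (List.ofFn z) T := hz
  rw [FailsBound] at hz'
  have h1 : ensembleError D (10 / 243) (ensemble A k (List.ofFn z) T) ≤ D.real R := by
    refine measureReal_mono fun x hx => ?_
    by_contra hxR
    have hx' : 10 / 243 ≤ avgErr (ensemble A k (List.ofFn z) T) x := hx
    have h0 : (ensemble A k (List.ofFn z) T).countP (fun g => g x.1 ≠ x.2) = 0 := by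
      rw [List.countP_eq_zero]
      intro g hg
      obtain ⟨S', -, rfl⟩ := List.mem_map.1 hg
      rw [eq_of_vcDim_eq_zero hd (hA S').1 hh]
      simpa [R] using hxR
    rw [avgErr, h0] at hx'
    norm_num at hx'
  have h2 := hcount h T z
  rw [errCount_ofFn] at h2
  have h3 : ((Finset.univ.filter fun a => z (e a) ∈ R).card : ℝ) ≤
      maxErr h k (List.ofFn z) T := by exact_mod_cast h2
  have h4 : (3 : ℝ) ^ k ≤ 29 * n := by exact_mod_cast hn
  have h5 : (3 : ℝ) ^ k * ensembleError D (10 / 243) (ensemble A k (List.ofFn z) T) ≤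
      29 * n * D.real R := by
    gcongr
    exact measureReal_nonneg
  have h6 : (0 : ℝ) ≤ maxErr h k (List.ofFn z) T := Nat.cast_nonneg _
  rw [Fintype.card_fin]
  simp only [Nat.cast_zero, zero_mul, add_zero]
  linarith

end Main

end AgnosticVC

end

theorem mainTheorem4 :
    ∃ c : ℝ, 1 ≤ c ∧
      ∀ (X : Type*) [MeasurableSpace X]
        (H : Set (AgnosticVC.Hypothesis X)) (d : ℕ)
        (A : AgnosticVC.Learner X)
        (D : Measure (AgnosticVC.Example X)) [IsProbabilityMeasure D]
        (hStar : AgnosticVC.Hypothesis X)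
        (δ : ℝ) (k m : ℕ) (T : List (AgnosticVC.Example X)),
        (∀ h ∈ H, Measurable h) →
        AgnosticVC.vcDim H = (d : ℕ∞) →
        AgnosticVC.IsERM H A →
        AgnosticVC.IsMeasurableLearner A →
        AgnosticVC.IsBest D H hStar →
        0 < δ → δ < 1 →
        m = 3 ^ k →
        1 - δ ≤ (Measure.pi fun _ : Fin m => D).real
          {S : Fin m → AgnosticVC.Example X |
            AgnosticVC.ensembleError D (10 / 243) (AgnosticVC.ensemble A k (List.ofFn S) T) ≤
              (⨆ S' : {S' // S' ∈ AgnosticVC.split k (List.ofFn S) T},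
                c * (AgnosticVC.errCount hStar S'.1 : ℝ) / ((m : ℝ) / AgnosticVC.sCap)) +
              c * ((d : ℝ) + Real.log (1 / δ)) / (m : ℝ)} := by
  refine ⟨3 ^ 16, by norm_num, ?_⟩
  intro X _ H d A D _ hStar δ k m T hm hd hA hAm hbest hδ0 hδ1 hmk
  subst hmk
  have hL : 0 ≤ Real.log (1 / δ) := Real.log_nonneg (by rw [le_div_iff₀ hδ0]; linarith)
  have hexp : Real.exp (-Real.log (1 / δ)) = δ := by
    rw [Real.exp_neg, Real.exp_log (by positivity), one_div, inv_inv]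
  set B : Set (Fin (3 ^ k) → AgnosticVC.Example X) :=
    {z | AgnosticVC.FailsBound D A hStar (3 ^ 16) k (d + Real.log (1 / δ)) (List.ofFn z) T}
  have hB : (Measure.pi fun _ : Fin (3 ^ k) => D) B ≤ ENNReal.ofReal δ := by
    rw [← hexp]
    rcases Nat.eq_zero_or_pos d with rfl | hd1
    · have := AgnosticVC.measure_failsBound_le_of_vcDim_eq_zero (D := D) hd hm hA hbest.1 k hL T
      simpa [B] using this
    · exact AgnosticVC.measure_failsBound_le hd hd1 hm hA hAm hbest.1 k hL T
  have hBr : (Measure.pi fun _ : Fin (3 ^ k) => D).real B ≤ δ :=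
    ENNReal.toReal_le_of_le_ofReal hδ0.le hB
  have hcompl : Bᶜ ⊆ {S : Fin (3 ^ k) → AgnosticVC.Example X |
            AgnosticVC.ensembleError D (10 / 243) (AgnosticVC.ensemble A k (List.ofFn S) T) ≤
              (⨆ S' : {S' // S' ∈ AgnosticVC.split k (List.ofFn S) T},
                3 ^ 16 * (AgnosticVC.errCount hStar S'.1 : ℝ) /
                  (((3 ^ k : ℕ) : ℝ) / AgnosticVC.sCap)) +
              3 ^ 16 * ((d : ℝ) + Real.log (1 / δ)) / ((3 ^ k : ℕ) : ℝ)} := by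
    intro z hz
    have := AgnosticVC.le_iSup_of_not_failsBound (by norm_num) hz
    simpa only [Set.mem_ofPred_eq, Nat.cast_pow, Nat.cast_ofNat] using this
  -- Subadditivity suffices here, without measurability of `B`.
  have hone : (1 : ℝ) ≤ (Measure.pi fun _ : Fin (3 ^ k) => D).real B +
      (Measure.pi fun _ : Fin (3 ^ k) => D).real Bᶜ := by
    have := measureReal_union_le (μ := Measure.pi fun _ : Fin (3 ^ k) => D) B Bᶜ
    rwa [Set.union_compl_self, probReal_univ] at this
  refine le_trans ?_ (measureReal_mono hcompl)
  linarith
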